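/- Let $0<\alpha<2$ and $0<\beta<1$. Let $B_{\alpha/2}=(B_{\alpha/2}(t))_{0\le t\le 1}$ be fractional Brownian motion with Hurst parameter $H=\alpha/2$, i.e. the centred Gaussian process with covariance $\tfrac12\big(s^{2H}+t^{2H}-|t-s|^{2H}\big)$. Let $L_\beta$ be a positive random variable, independent of $B_{\alpha/2}$, whose density on $(0,\infty)$ is the $M$-Wright function $$M_\beta(x)=\sum_{n=0}^\infty \frac{(-x)^n}{n!\,\Gamma(1-\beta-\beta n)},$$ where $1/\Gamma$ is $0$ at the poles of $\Gamma$. Generalized grey Brownian motion is the process $B_{\alpha,\beta}$ that has the law of $\big(\sqrt{L_\beta}\,B_{\alpha/2}(t)\big)_{0\le t\le1}$. Let $0<\gamma<\alpha/2$, and let $\|\cdot\|$ be a norm on the space $C_0^\gamma[0,1]$ of $\gamma$-Hölder continuous functions $f:[0,1]\to\mathbb R$ with $f(0)=0$ that is measurable with respect to the $\sigma$-algebra generated by the point evaluations. Take versions of $B_{\alpha/2}$ and $B_{\alpha,\beta}$ with paths in $C_0^\gamma[0,1]$, and assume that there are $\theta,C_1,C_2>0$ such that $$-C_1\varepsilon^{-\theta}\le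 \log\mathbb P\big[\|B_{\alpha/2}\|\le\varepsilon\big]\le -C_2\varepsilon^{-\theta},\qquad \varepsilon\in(0,1].$$ Then the cumulative distribution function $\varepsilon\mapsto\mathbb P[\|B_{\alpha,\beta}\|\le\varepsilon]$ is real-analytic on $(0,\infty)$. In particular, without any further assumption, for a version of $B_{\alpha,\beta}$ with almost surely continuous paths, the cumulative distribution function of $\sup_{0\le t\le1}|B_{\alpha,\beta}(t)|$ is real-analytic on $(0,\infty)$. -/

import Mathlib

open MeasureTheory ProbabilityTheory Set
open scoped NNReal ENNReal

/-- The `M`-Wright function `M_β(x) = ∑ (-x)^n / (n! Γ(1 - β - β n))`. At the poles of `Γ` Mathlib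
sets `Γ = 0`, so the corresponding term is `0`, in accordance with `1 / Γ = 0` there. -/
noncomputable def mWright (β x : ℝ) : ℝ :=
  ∑' n : ℕ, (-x) ^ n / ((n.factorial : ℝ) * Real.Gamma (1 - β - β * n))

/-- The measure on `(0, ∞)` whose Lebesgue density is `M_β`. -/
noncomputable def mWrightMeasure (β : ℝ) : Measure ℝ :=
  (volume.restrict (Ioi 0)).withDensity (fun x => ENNReal.ofReal (mWright β x))

/-- The process `B` on the time interval `[0, 1]` has the finite-dimensional distributions of
fractional Brownian motion with Hurst parameter `H`: it is Gaussian and centred, with covariance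
`(s^{2H} + t^{2H} - |t - s|^{2H}) / 2`. Path regularity is stated separately. -/
structure IsFractionalBM {Ω : Type*} [MeasurableSpace Ω] (H : ℝ) (B : unitInterval → Ω → ℝ)
    (P : Measure Ω) : Prop where
  gaussian : IsGaussianProcess B P
  centred : ∀ t, ∫ ω, B t ω ∂P = 0
  covariance_eq : ∀ s t : unitInterval, covariance (B s) (B t) P =
    ((s : ℝ) ^ (2 * H) + (t : ℝ) ^ (2 * H) - |(t : ℝ) - (s : ℝ)| ^ (2 * H)) / 2

/-- The process `X` on `[0, 1]` is a generalized grey Brownian motion `B_{α,β}`: it has the same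
finite-dimensional distributions as `√L · B`, where `B` is a fractional Brownian motion with Hurst
parameter `α / 2` and `L` is independent of (the whole process) `B` and has density `M_β` on
`(0, ∞)`. -/
def IsGeneralizedGreyBM {Ω : Type*} [MeasurableSpace Ω] (α β : ℝ) (X : unitInterval → Ω → ℝ)
    (P : Measure Ω) : Prop :=
  ∃ (Ω' : Type) (_ : MeasurableSpace Ω') (P' : Measure Ω') (L : Ω' → ℝ)
    (B : unitInterval → Ω' → ℝ),
    IsProbabilityMeasure P' ∧
    HasLaw L (mWrightMeasure β) P' ∧
    IsFractionalBM (α / 2) B P' ∧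
    IndepFun L (fun ω t => B t ω) P' ∧
    ∀ I : Finset unitInterval,
      IdentDistrib (fun ω => I.restrict (fun t => X t ω))
        (fun ω => I.restrict (fun t => √(L ω) * B t ω)) P P'

/-- The space `C_0^γ[0, 1]` of `γ`-Hölder continuous functions on `[0, 1]` vanishing at `0`. As a
subtype of `[0, 1] → ℝ` it carries the `σ`-algebra generated by the point evaluations. -/
def HolderZero (γ : ℝ≥0) : Submodule ℝ (unitInterval → ℝ) where
  carrier := {f | f 0 = 0 ∧ MemHolder γ f}
  zero_mem' := ⟨rfl, memHolder_zero⟩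
  add_mem' := fun {f g} hf hg => ⟨by simp [hf.1, hg.1], hf.2.add hg.2⟩
  smul_mem' := fun c f hf => ⟨by simp [hf.1], hf.2.smul⟩

/-- The exponential small ball estimate for a cumulative distribution function `F`: for some
`θ, C₁, C₂ > 0`, one has `-C₁ ε^{-θ} ≤ log F(ε) ≤ -C₂ ε^{-θ}` for all `ε ∈ (0, 1]`. -/
def SmallBallEstimate (F : ℝ → ℝ) : Prop :=
  ∃ θ > (0 : ℝ), ∃ C₁ > (0 : ℝ), ∃ C₂ > (0 : ℝ), ∀ ε ∈ Ioc (0 : ℝ) 1,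
    -C₁ * ε ^ (-θ) ≤ Real.log (F ε) ∧ Real.log (F ε) ≤ -C₂ * ε ^ (-θ)

/-! The law of the process is that of `√l · B` with `l` independent of `B`, so by homogeneity the
norm is distributed as `√l · R`, with `R` the norm of `B`. Conditioning on `R` gives `P[R = 0] +
E[F(ε² / R²); 0 < R < ∞]`, where `F` is the distribution function of `l`. Everything rests on
extending `F` holomorphically to a sector around `(0, ∞)` with a bound that is invariant under
dilations; `R` may then be any random variable in `[0, ∞]`.

The extension comes from integrating along a rotated ray (`mWright_eq`): with `w = exp(iθ)`, `θ =
πβ/(1+β) < π/2`, the density is `1/π` times the imaginary part of `∫ t^(β-1) exp(-w̄ t) w exp(-x w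
t^β) dt`. This converges for `x` in a sector and is `O(1 / Re x)` there. So `‖F'(z)‖ ≤ C / Re z`;
since `0 ≤ F ≤ 1` on the reals, `F` is bounded on the sector, and one may differentiate `E[F(ζ /
R²)]` under the integral (`differentiableOn_integral_comp_mul`).

The measure `mWrightMeasure` only sees the positive part of `M_β`, so identifying `F` with the
primitive of `M_β` requires `M_β ≥ 0`. This is deduced in `mWright_nonneg_ae` from total mass one
and the Mellin transform of `M_β` near `s = 1`. -/

/-! ### Finite-dimensional distributions and laws of the processes. -/

/-- Two real Gaussian processes with the same mean and covariance functions have the same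
finite-dimensional distributions. -/
theorem IsGaussianProcess.map_restrict_eq {T Ω Ω' : Type*} [MeasurableSpace Ω]
    [MeasurableSpace Ω'] {X : T → Ω → ℝ} {Y : T → Ω' → ℝ} {P : Measure Ω} {P' : Measure Ω'}
    (hX : IsGaussianProcess X P) (hY : IsGaussianProcess Y P')
    (hm : ∀ t, ∫ ω, X t ω ∂P = ∫ ω, Y t ω ∂P')
    (hc : ∀ s t, cov[X s, X t; P] = cov[Y s, Y t; P']) (I : Finset T) :
    P.map (fun ω => I.restrict (X · ω)) = P'.map (fun ω => I.restrict (Y · ω)) := by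
  classical
  have := hX.isProbabilityMeasure
  have := hY.isProbabilityMeasure
  have gX := (hX.hasGaussianLaw I).isGaussian_map
  have gY := (hY.hasGaussianLaw I).isGaussian_map
  have aX : AEMeasurable (fun ω => I.restrict (X · ω)) P := (hX.hasGaussianLaw I).aemeasurable
  have aY : AEMeasurable (fun ω => I.restrict (Y · ω)) P' := (hY.hasGaussianLaw I).aemeasurable
  have mX (t : T) : MemLp (X t) 2 P := (hX.hasGaussianLaw_eval t).memLp_two
  have mY (t : T) : MemLp (Y t) 2 P' := (hY.hasGaussianLaw_eval t).memLp_two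
  -- The characteristic function of a Gaussian measure depends only on the mean and variance of each
  -- linear functional; expanding the functional in coordinates reduces these to means and
  -- covariances.
  refine Measure.ext_of_charFunDual ?_
  ext L
  have hL (x : I → ℝ) : L x = ∑ i, L (Pi.single i 1) * x i := by
    conv_lhs => rw [← Finset.univ_sum_single x]
    rw [map_sum]
    refine Finset.sum_congr rfl fun i _ => ?_
    have : Pi.single i (x i) = x i • (Pi.single i 1 : I → ℝ) := by
      rw [← Pi.single_smul]; simp
    rw [this, map_smul, smul_eq_mul, mul_comm]
  have hLX : (fun ω => L (I.restrict (X · ω))) =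
      fun ω => ∑ i : I, L (Pi.single i 1) * X i ω := by
    funext ω; rw [hL]; rfl
  have hLY : (fun ω => L (I.restrict (Y · ω))) =
      fun ω => ∑ i : I, L (Pi.single i 1) * Y i ω := by
    funext ω; rw [hL]; rfl
  have e1 : ∫ x, L x ∂(P.map (fun ω => I.restrict (X · ω))) =
      ∫ x, L x ∂(P'.map (fun ω => I.restrict (Y · ω))) := by
    rw [integral_map aX (by fun_prop), integral_map aY (by fun_prop), hLX, hLY,
      integral_finsetSum (f := fun (i : I) ω => L (Pi.single i 1) * X i ω) _
        fun i _ => ((mX i).integrable (by norm_num)).const_mul _,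
      integral_finsetSum (f := fun (i : I) ω => L (Pi.single i 1) * Y i ω) _
        fun i _ => ((mY i).integrable (by norm_num)).const_mul _]
    simp_rw [integral_const_mul, hm]
  have e2 : Var[L; P.map (fun ω => I.restrict (X · ω))] =
      Var[L; P'.map (fun ω => I.restrict (Y · ω))] := by
    rw [variance_map (by fun_prop) aX, variance_map (by fun_prop) aY]
    change Var[fun ω => L (I.restrict (X · ω)); P] = Var[fun ω => L (I.restrict (Y · ω)); P']
    rw [hLX, hLY, ← covariance_self, ← covariance_self,
      covariance_fun_sum_fun_sum (fun i : I => (mX i).const_mul _)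
        (fun i : I => (mX i).const_mul _),
      covariance_fun_sum_fun_sum (fun i : I => (mY i).const_mul _)
        (fun i : I => (mY i).const_mul _)]
    · simp_rw [covariance_const_mul_left, covariance_const_mul_right, hc]
    · exact Finset.aemeasurable_fun_sum _ fun i _ => (mY i).aemeasurable.const_mul _
    · exact Finset.aemeasurable_fun_sum _ fun i _ => (mX i).aemeasurable.const_mul _
  rw [IsGaussian.charFunDual_eq, IsGaussian.charFunDual_eq, integral_complex_ofReal,
    integral_complex_ofReal, e1, e2]

theorem IsFractionalBM.map_restrict_eq {Ω Ω' : Type*} [MeasurableSpace Ω] [MeasurableSpace Ω']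
    {H : ℝ} {B : unitInterval → Ω → ℝ} {B' : unitInterval → Ω' → ℝ} {P : Measure Ω}
    {P' : Measure Ω'} (hB : IsFractionalBM H B P) (hB' : IsFractionalBM H B' P')
    (I : Finset unitInterval) :
    P.map (fun ω => I.restrict (B · ω)) = P'.map (fun ω => I.restrict (B' · ω)) :=
  IsGaussianProcess.map_restrict_eq hB.gaussian hB'.gaussian
    (fun t => by rw [hB.centred, hB'.centred])
    (fun s t => by rw [hB.covariance_eq, hB'.covariance_eq]) I

/-- Total mass one is not computed from the series: it is inherited from the random variable `L`
whose law this is. -/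
theorem IsGeneralizedGreyBM.isProbabilityMeasure_mWrightMeasure {Ω : Type*} [MeasurableSpace Ω]
    {α β : ℝ} {X : unitInterval → Ω → ℝ} {P : Measure Ω} (hX : IsGeneralizedGreyBM α β X P) :
    IsProbabilityMeasure (mWrightMeasure β) := by
  obtain ⟨Ω₁, _, P₁, L, B₁, _, hL, -⟩ := hX
  rw [← hL.map_eq]
  exact Measure.isProbabilityMeasure_map hL.aemeasurable

/-- The finite-dimensional distributions of a generalized grey Brownian motion are those of
`√l · B` under the product of the `M`-Wright measure with the law of any fractional Brownian
motion `B`. -/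
theorem IsGeneralizedGreyBM.identDistrib_prod {Ω Ω' : Type*} [MeasurableSpace Ω]
    [MeasurableSpace Ω'] {α β : ℝ} {X : unitInterval → Ω → ℝ} {B : unitInterval → Ω' → ℝ}
    {P : Measure Ω} {P' : Measure Ω'} (hX : IsGeneralizedGreyBM α β X P)
    (hB : IsFractionalBM (α / 2) B P') (I : Finset unitInterval) :
    IdentDistrib (fun ω => I.restrict (X · ω))
      (fun p : ℝ × Ω' => I.restrict fun t => √p.1 * B t p.2) P ((mWrightMeasure β).prod P') := by
  have := hX.isProbabilityMeasure_mWrightMeasure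
  have := hB.gaussian.isProbabilityMeasure
  obtain ⟨Ω₁, _, P₁, L, B₁, _, hL, hB₁, hind, hfdd⟩ := hX
  refine (hfdd I).trans ?_
  let g : ℝ × (I → ℝ) → I → ℝ := fun p t => √p.1 * p.2 t
  have hg : Measurable g := by fun_prop
  have a₁ : AEMeasurable (fun ω => I.restrict (B₁ · ω)) P₁ :=
    (hB₁.gaussian.hasGaussianLaw I).aemeasurable
  have a : AEMeasurable (fun ω => I.restrict (B · ω)) P' :=
    (hB.gaussian.hasGaussianLaw I).aemeasurable
  have ap : AEMeasurable (fun p : ℝ × Ω' => (p.1, I.restrict (B · p.2)))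
      ((mWrightMeasure β).prod P') :=
    measurable_fst.aemeasurable.prodMk a.comp_snd
  have key : IdentDistrib (fun ω => (L ω, I.restrict (B₁ · ω)))
      (fun p : ℝ × Ω' => (p.1, I.restrict (B · p.2))) P₁ ((mWrightMeasure β).prod P') := by
    refine ⟨hL.aemeasurable.prodMk a₁, ap, ?_⟩
    have hi : IndepFun L (fun ω => I.restrict (B₁ · ω)) P₁ :=
      hind.comp (φ := id) measurable_id (Finset.measurable_restrict I)
    rw [hi.map_prod_eq_prod_map_map hL.aemeasurable a₁, hL.map_eq, hB₁.map_restrict_eq hB I]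
    have h := (indepFun_prod₀ (μ := mWrightMeasure β) (ν := P') aemeasurable_id
      a).map_prod_eq_prod_map_map measurable_fst.aemeasurable a.comp_snd
    refine Eq.trans ?_ h.symm
    congr 1
    · exact (measurePreserving_fst (μ := mWrightMeasure β) (ν := P')).map_eq.symm
    · have hs := (measurePreserving_snd (μ := mWrightMeasure β) (ν := P')).map_eq
      have h := AEMeasurable.map_map_of_aemeasurable (f := (Prod.snd : ℝ × Ω' → Ω'))
        (μ := (mWrightMeasure β).prod P') (hs ▸ a) measurable_snd.aemeasurable
      rwa [hs] at h
  exact key.comp hg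

/-- Equality of finite-dimensional distributions implies equality of laws. -/
theorem identDistrib_of_forall_finset {T Ω Ω' : Type*} [MeasurableSpace Ω]
    [MeasurableSpace Ω'] {X : T → Ω → ℝ} {Y : T → Ω' → ℝ} {P : Measure Ω} {P' : Measure Ω'}
    [IsFiniteMeasure P]
    (hX : AEMeasurable (fun ω t => X t ω) P) (hY : AEMeasurable (fun ω t => Y t ω) P')
    (h : ∀ I : Finset T, IdentDistrib (fun ω => I.restrict (X · ω))
      (fun ω => I.restrict (Y · ω)) P P') :
    IdentDistrib (fun ω t => X t ω) (fun ω t => Y t ω) P P' := by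
  refine ⟨hX, hY, ?_⟩
  have h₁ := isProjectiveLimit_map hX
  have h₂ := isProjectiveLimit_map hY
  simp_rw [(h _).map_eq] at h₁
  have (I : Finset T) : IsFiniteMeasure (P'.map fun ω => I.restrict (Y · ω)) := by
    rw [← (h I).map_eq]; infer_instance
  exact h₁.unique h₂

/-! ### Gamma integrals along rays and the reflection formula. -/

theorem integrableOn_rpow_mul_exp_neg_mul {a c : ℝ} (ha : 0 < a) (hc : 0 < c) :
    IntegrableOn (fun t : ℝ => t ^ (a - 1) * Real.exp (-(c * t))) (Ioi 0) := by
  have h := integrableOn_rpow_mul_exp_neg_mul_rpow (p := 1) (s := a - 1) (b := c) (by linarith)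
    one_pos hc
  simpa using h

theorem Complex.norm_exp_neg_mul_ofReal (r : ℂ) (t : ℝ) :
    ‖Complex.exp (-(r * t))‖ = Real.exp (-(r.re * t)) := by
  rw [Complex.norm_exp]; simp

/-- Mean value inequality on the closed right half-plane, where the derivative has norm at most `1`.
It tames the factor `1 / t` in `wrightPrimitiveKernel` near `0`. -/
theorem Complex.norm_one_sub_exp_neg_le {u : ℂ} (hu : 0 ≤ u.re) :
    ‖1 - Complex.exp (-u)‖ ≤ ‖u‖ := by
  have hconv : Convex ℝ {z : ℂ | 0 ≤ z.re} := convex_halfSpace_re_ge 0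
  have h := hconv.norm_image_sub_le_of_norm_hasDerivWithin_le (f := fun z => Complex.exp (-z))
    (f' := fun z => -Complex.exp (-z)) (C := 1)
    (fun z _ => by
      simpa using ((hasDerivAt_neg z).cexp).hasDerivWithinAt)
    (fun z hz => by
      rw [norm_neg, Complex.norm_exp]
      have : 0 ≤ z.re := hz
      simpa using this)
    hu (by simp : (0 : ℂ) ∈ {z : ℂ | 0 ≤ z.re})
  simpa using h

/-- The Gamma integral along a rotated ray. -/
theorem Complex.integral_rpow_mul_exp_neg_mul {a : ℝ} (ha : 0 < a) {r : ℂ} (hr : 0 < r.re) :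
    ∫ t : ℝ in Ioi 0, ((t ^ (a - 1) : ℝ) : ℂ) * Complex.exp (-(r * t)) =
      r ^ (-a : ℂ) * Real.Gamma a := by
  set U : Set ℂ := {z | 0 < z.re} with hU
  have oU : IsOpen U := isOpen_lt continuous_const Complex.continuous_re
  have key : EqOn (fun r : ℂ => ∫ t : ℝ in Ioi 0, ((t ^ (a - 1) : ℝ) : ℂ) * Complex.exp (-(r * t)))
      (fun r => r ^ (-a : ℂ) * Real.Gamma a) U := by
    have hd : DifferentiableOn ℂ
        (fun r : ℂ => ∫ t : ℝ in Ioi 0, ((t ^ (a - 1) : ℝ) : ℂ) * Complex.exp (-(r * t))) U := by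
      intro r₀ hr₀
      have hr₀' : 0 < r₀.re := hr₀
      have hs : {z : ℂ | r₀.re / 2 < z.re} ∈ nhds r₀ :=
        (isOpen_lt continuous_const Complex.continuous_re).mem_nhds
          (by simpa using hr₀')
      have hm (r : ℂ) : AEStronglyMeasurable
          (fun t : ℝ => ((t ^ (a - 1) : ℝ) : ℂ) * Complex.exp (-(r * t)))
          (volume.restrict (Ioi 0)) := by
        refine Measurable.aestronglyMeasurable ?_
        fun_prop
      refine (hasDerivAt_integral_of_dominated_loc_of_deriv_le
        (F' := fun r t => ((t ^ (a - 1) : ℝ) : ℂ) * (Complex.exp (-(r * t)) * (-t)))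
        (bound := fun t => t ^ (a + 1 - 1) * Real.exp (-(r₀.re / 2 * t)))
        hs (Filter.Eventually.of_forall hm) ?_ ?_ ?_ ?_ ?_).2.differentiableAt.differentiableWithinAt
      · refine (integrableOn_rpow_mul_exp_neg_mul ha hr₀').mono' (hm r₀) ?_
        refine (ae_restrict_iff' measurableSet_Ioi).2 (ae_of_all _ fun t ht => ?_)
        rw [norm_mul, Complex.norm_exp_neg_mul_ofReal, Complex.norm_real,
          Real.norm_of_nonneg (Real.rpow_nonneg (le_of_lt ht) _)]
      · refine Measurable.aestronglyMeasurable ?_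
        fun_prop
      · refine (ae_restrict_iff' measurableSet_Ioi).2 (ae_of_all _ fun t ht r hr => ?_)
        have ht' : 0 < t := ht
        rw [norm_mul, norm_mul, Complex.norm_exp_neg_mul_ofReal, Complex.norm_real, norm_neg,
          Complex.norm_real, Real.norm_of_nonneg (Real.rpow_nonneg ht'.le _),
          Real.norm_of_nonneg ht'.le, add_sub_right_comm, Real.rpow_add_one ht'.ne',
          mul_comm (Real.exp _), ← mul_assoc]
        have : r₀.re / 2 < r.re := hr
        gcongr
      · exact integrableOn_rpow_mul_exp_neg_mul (by linarith) (by linarith)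
      · refine (ae_of_all _ fun t r _ => ?_)
        have h : HasDerivAt (fun r : ℂ => -(r * t)) (-(t : ℂ)) r :=
          (hasDerivAt_mul_const (t : ℂ)).fun_neg
        exact (h.cexp).const_mul _
    have hg : DifferentiableOn ℂ (fun r : ℂ => r ^ (-a : ℂ) * (Real.Gamma a : ℂ)) U := by
      intro r hr
      refine (DifferentiableAt.mul_const ?_ _).differentiableWithinAt
      exact differentiableAt_id.cpow_const (Or.inl hr)
    -- Identity theorem: both sides are holomorphic in the half-plane and agree at the real points
    -- `x > 1`, which accumulate at `1`.
    refine (hd.analyticOnNhd oU).eqOn_of_preconnected_of_mem_closure (hg.analyticOnNhd oU)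
      (convex_halfSpace_re_gt 0).isPreconnected (z₀ := 1) (by simp [hU]) ?_
    have hlim : Filter.Tendsto (fun x : ℝ => (x : ℂ)) (nhdsWithin 1 (Ioi 1)) (nhds 1) := by
      have := (Complex.continuous_ofReal.tendsto (1 : ℝ)).mono_left
        (nhdsWithin_le_nhds (s := Ioi (1 : ℝ)))
      simpa using this
    refine mem_closure_of_tendsto hlim ?_
    filter_upwards [self_mem_nhdsWithin] with x hx
    have hx1 : (1 : ℝ) < x := hx
    have hx0 : 0 < x := by linarith
    refine ⟨?_, by simpa using hx1.ne'⟩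
    have h := Real.integral_rpow_mul_exp_neg_mul_Ioi ha hx0
    have hh : ∫ t : ℝ in Ioi 0, ((t ^ (a - 1) : ℝ) : ℂ) * Complex.exp (-((x : ℂ) * t)) =
        ((∫ t : ℝ in Ioi 0, t ^ (a - 1) * Real.exp (-(x * t)) : ℝ) : ℂ) := by
      rw [← integral_complex_ofReal]
      congr 1; funext t; push_cast; rfl
    change _ = _
    rw [hh, h, one_div, Real.inv_rpow hx0.le, ← Real.rpow_neg hx0.le]
    push_cast
    rw [Complex.ofReal_cpow hx0.le]
    push_cast; rfl
  exact key hr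

/-- Euler's reflection formula. Where the sine vanishes, `1 - a` is a pole, and the convention `Γ =
0` there makes both sides `0`. -/
theorem Real.one_div_Gamma_one_sub {a : ℝ} (ha : 0 < a) :
    1 / Real.Gamma (1 - a) = Real.Gamma a * Real.sin (Real.pi * a) / Real.pi := by
  have h := Real.Gamma_mul_Gamma_one_sub a
  have hg := (Real.Gamma_pos_of_pos ha).ne'
  by_cases hs : Real.sin (Real.pi * a) = 0
  · rw [hs, div_zero, mul_eq_zero] at h
    rw [hs, h.resolve_left hg]; simp
  · have h1 : Real.Gamma (1 - a) ≠ 0 := by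
      intro h0
      rw [h0, mul_zero] at h
      exact (div_ne_zero Real.pi_ne_zero hs) h.symm
    rw [eq_div_iff hs] at h
    rw [div_eq_div_iff h1 Real.pi_ne_zero]
    linarith

/-! ### Integral representation of the `M`-Wright function. -/

/-- The argument of the ray on which the `M`-Wright function is represented. -/
noncomputable def wrightAngle (β : ℝ) : ℝ := Real.pi * β / (1 + β)

/-- The unit complex number spanning the ray on which the `M`-Wright function is represented. -/
noncomputable def wrightDir (β : ℝ) : ℂ := Complex.exp (wrightAngle β * Complex.I)

/-- The conjugate of `wrightDir`. -/
noncomputable def wrightDirConj (β : ℝ) : ℂ := Complex.exp (-(wrightAngle β * Complex.I))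

/-- The angle solves `θ (1 + β) = πβ`, so that `w^(n+1) · w̄^(-β(n+1)) = exp(iπβ(n+1))`. Because `β
< 1`, it stays below `π/2`, so `w` and `w̄` both have positive real part and both exponentials in
the kernel decay for `z > 0`. -/
theorem wrightAngle_mem {β : ℝ} (hβ : 0 < β ∧ β < 1) :
    wrightAngle β ∈ Ioo 0 (Real.pi / 2) := by
  have := Real.pi_pos
  refine ⟨by unfold wrightAngle; have := hβ.1; positivity, ?_⟩
  unfold wrightAngle
  rw [div_lt_div_iff₀ (by linarith [hβ.1]) two_pos]
  nlinarith [hβ.2]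

theorem wrightDir_re (β : ℝ) : (wrightDir β).re = Real.cos (wrightAngle β) := by
  rw [wrightDir, Complex.exp_ofReal_mul_I_re]

theorem wrightDir_im (β : ℝ) : (wrightDir β).im = Real.sin (wrightAngle β) := by
  rw [wrightDir, Complex.exp_ofReal_mul_I_im]

theorem norm_wrightDir (β : ℝ) : ‖wrightDir β‖ = 1 := Complex.norm_exp_ofReal_mul_I _

theorem wrightDirConj_re (β : ℝ) : (wrightDirConj β).re = Real.cos (wrightAngle β) := by
  rw [wrightDirConj, ← neg_mul, ← Complex.ofReal_neg, Complex.exp_ofReal_mul_I_re, Real.cos_neg]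

theorem cos_wrightAngle_pos {β : ℝ} (hβ : 0 < β ∧ β < 1) : 0 < Real.cos (wrightAngle β) :=
  Real.cos_pos_of_mem_Ioo ⟨by linarith [(wrightAngle_mem hβ).1, Real.pi_pos],
    (wrightAngle_mem hβ).2⟩

theorem wrightDirConj_cpow {β : ℝ} (hβ : 0 < β ∧ β < 1) (a : ℝ) :
    wrightDirConj β ^ (-a : ℂ) = Complex.exp (wrightAngle β * a * Complex.I) := by
  have h := wrightAngle_mem hβ
  have hp := Real.pi_pos
  rw [wrightDirConj, Complex.cpow_def_of_ne_zero (Complex.exp_ne_zero _), Complex.log_exp]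
  · congr 1; ring
  · simp; linarith [h.2]
  · simp; linarith [h.1]

/-- The integrand of `wrightIntegral`. -/
noncomputable def wrightKernel (β : ℝ) (z : ℂ) (t : ℝ) : ℂ :=
  ((t ^ (β - 1) : ℝ) : ℂ) * (Complex.exp (-(wrightDirConj β * t)) *
    (wrightDir β * Complex.exp (-(z * wrightDir β * (t ^ β : ℝ)))))

/-- The complex function whose imaginary part represents the `M`-Wright function. -/
noncomputable def wrightIntegral (β : ℝ) (z : ℂ) : ℂ := ∫ t : ℝ in Ioi 0, wrightKernel β z t

/-- The integrand of `wrightPrimitive`. -/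
noncomputable def wrightPrimitiveKernel (β : ℝ) (z : ℂ) (t : ℝ) : ℂ :=
  ((t⁻¹ : ℝ) : ℂ) * (Complex.exp (-(wrightDirConj β * t)) *
    (1 - Complex.exp (-(z * wrightDir β * (t ^ β : ℝ)))))

/-- A primitive of `wrightIntegral`, vanishing at `0`. -/
noncomputable def wrightPrimitive (β : ℝ) (z : ℂ) : ℂ :=
  ∫ t : ℝ in Ioi 0, wrightPrimitiveKernel β z t

theorem measurable_wrightKernel (β : ℝ) :
    Measurable (fun p : ℂ × ℝ => wrightKernel β p.1 p.2) := by
  unfold wrightKernel; fun_prop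

theorem measurable_wrightPrimitiveKernel (β : ℝ) (z : ℂ) :
    Measurable (wrightPrimitiveKernel β z) := by
  unfold wrightPrimitiveKernel; fun_prop

theorem norm_wrightKernel (β : ℝ) (z : ℂ) {t : ℝ} (ht : 0 < t) :
    ‖wrightKernel β z t‖ = t ^ (β - 1) * Real.exp (-(Real.cos (wrightAngle β) * t)) *
      Real.exp (-((z * wrightDir β).re * t ^ β)) := by
  rw [wrightKernel, norm_mul, norm_mul, norm_mul, Complex.norm_exp_neg_mul_ofReal,
    Complex.norm_exp_neg_mul_ofReal, Complex.norm_real,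
    Real.norm_of_nonneg (Real.rpow_nonneg ht.le _), norm_wrightDir, wrightDirConj_re]
  ring

theorem norm_wrightPrimitiveKernel_le (β : ℝ) {z : ℂ} (hz : 0 ≤ (z * wrightDir β).re) {t : ℝ}
    (ht : 0 < t) : ‖wrightPrimitiveKernel β z t‖ ≤
      ‖z‖ * (t ^ (β - 1) * Real.exp (-(Real.cos (wrightAngle β) * t))) := by
  have h : ‖1 - Complex.exp (-(z * wrightDir β * (t ^ β : ℝ)))‖ ≤ ‖z‖ * t ^ β := by
    refine (Complex.norm_one_sub_exp_neg_le ?_).trans_eq ?_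
    · rw [Complex.re_mul_ofReal]; exact mul_nonneg hz (Real.rpow_nonneg ht.le _)
    · rw [norm_mul, norm_mul, norm_wrightDir, Complex.norm_real,
        Real.norm_of_nonneg (Real.rpow_nonneg ht.le _), mul_one]
  rw [wrightPrimitiveKernel, norm_mul, norm_mul, Complex.norm_exp_neg_mul_ofReal,
    Complex.norm_real, Real.norm_of_nonneg (inv_nonneg.2 ht.le), wrightDirConj_re,
    Real.rpow_sub_one ht.ne', div_eq_mul_inv]
  calc _ ≤ t⁻¹ * (Real.exp (-(Real.cos (wrightAngle β) * t)) * (‖z‖ * t ^ β)) := by gcongr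
    _ = _ := by ring

/-- The total mass of the dominating function of the kernels. -/
noncomputable def wrightBound (β : ℝ) : ℝ :=
  ∫ t : ℝ in Ioi 0, t ^ (β - 1) * Real.exp (-(Real.cos (wrightAngle β) * t))

theorem norm_wrightPrimitive_le {β : ℝ} (hβ : 0 < β ∧ β < 1) {z : ℂ}
    (hz : 0 ≤ (z * wrightDir β).re) : ‖wrightPrimitive β z‖ ≤ ‖z‖ * wrightBound β := by
  rw [wrightBound, ← integral_const_mul]
  refine norm_integral_le_of_norm_le
    ((integrableOn_rpow_mul_exp_neg_mul hβ.1 (cos_wrightAngle_pos hβ)).const_mul _) ?_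
  exact (ae_restrict_iff' measurableSet_Ioi).2
    (ae_of_all _ fun t ht => norm_wrightPrimitiveKernel_le β hz ht)

theorem norm_wrightKernel_le (β : ℝ) {z : ℂ} (hz : 0 ≤ (z * wrightDir β).re) {t : ℝ}
    (ht : 0 < t) : ‖wrightKernel β z t‖ ≤
      t ^ (β - 1) * Real.exp (-(Real.cos (wrightAngle β) * t)) := by
  rw [norm_wrightKernel β z ht]
  refine mul_le_of_le_one_right (by positivity) ?_
  rw [Real.exp_le_one_iff]
  have := mul_nonneg hz (Real.rpow_nonneg ht.le β)
  linarith

theorem norm_wrightIntegral_le {β : ℝ} (hβ : 0 < β ∧ β < 1) {z : ℂ}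
    (hz : 0 ≤ (z * wrightDir β).re) : ‖wrightIntegral β z‖ ≤ wrightBound β :=
  norm_integral_le_of_norm_le
    (integrableOn_rpow_mul_exp_neg_mul hβ.1 (cos_wrightAngle_pos hβ))
    ((ae_restrict_iff' measurableSet_Ioi).2
      (ae_of_all _ fun _ ht => norm_wrightKernel_le β hz ht))

/-- Discarding the decay of `exp(-w̄ t)` leaves an integral that the substitution `u = t^β`
evaluates exactly. Homogeneity of degree `-1` in `z` is what later makes estimates uniform under
dilations. -/
theorem norm_wrightIntegral_le_inv {β : ℝ} (hβ : 0 < β ∧ β < 1) {z : ℂ}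
    (hz : 0 < (z * wrightDir β).re) :
    ‖wrightIntegral β z‖ ≤ 1 / (β * (z * wrightDir β).re) := by
  have hi := integral_rpow_mul_exp_neg_mul_rpow (p := β) (q := β - 1) hβ.1 (by linarith [hβ.1]) hz
  have hI := integrableOn_rpow_mul_exp_neg_mul_rpow (p := β) (s := β - 1) (by linarith [hβ.1])
    hβ.1 hz
  have hb : (z * wrightDir β).re ^ (-(β - 1 + 1) / β) * (1 / β) * Real.Gamma ((β - 1 + 1) / β) =
      1 / (β * (z * wrightDir β).re) := by
    rw [sub_add_cancel, neg_div, div_self hβ.1.ne', Real.Gamma_one, Real.rpow_neg_one]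
    field_simp
  rw [hb] at hi
  rw [← hi]
  refine norm_integral_le_of_norm_le hI ((ae_restrict_iff' measurableSet_Ioi).2
      (ae_of_all _ fun t ht => ?_))
  have ht' : 0 < t := ht
  rw [norm_wrightKernel β z ht, mul_assoc, neg_mul]
  refine mul_le_mul_of_nonneg_left ?_ (Real.rpow_nonneg ht'.le _)
  refine mul_le_of_le_one_left (Real.exp_nonneg _) ?_
  rw [Real.exp_le_one_iff]
  have := mul_pos (cos_wrightAngle_pos hβ) ht'
  linarith

theorem hasDerivAt_wrightPrimitive {β : ℝ} (hβ : 0 < β ∧ β < 1) {z : ℂ}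
    (hz : 0 < (z * wrightDir β).re) :
    HasDerivAt (wrightPrimitive β) (wrightIntegral β z) z := by
  have hs : {z : ℂ | 0 < (z * wrightDir β).re} ∈ nhds z :=
    (isOpen_lt continuous_const (by fun_prop)).mem_nhds hz
  refine (hasDerivAt_integral_of_dominated_loc_of_deriv_le
    (F := wrightPrimitiveKernel β) (F' := wrightKernel β)
    (bound := fun t => t ^ (β - 1) * Real.exp (-(Real.cos (wrightAngle β) * t))) hs
    (Filter.Eventually.of_forall fun z =>
      (measurable_wrightPrimitiveKernel β z).aestronglyMeasurable) ?_ ?_ ?_ ?_ ?_).2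
  · exact ((integrableOn_rpow_mul_exp_neg_mul hβ.1 (cos_wrightAngle_pos hβ)).const_mul ‖z‖).mono'
      (measurable_wrightPrimitiveKernel β z).aestronglyMeasurable
      ((ae_restrict_iff' measurableSet_Ioi).2
        (ae_of_all _ fun t ht => norm_wrightPrimitiveKernel_le β hz.le ht))
  · exact ((measurable_wrightKernel β).comp measurable_prodMk_left).aestronglyMeasurable
  · exact (ae_restrict_iff' measurableSet_Ioi).2
      (ae_of_all _ fun t ht z hz => norm_wrightKernel_le β (le_of_lt hz) ht)
  · exact integrableOn_rpow_mul_exp_neg_mul hβ.1 (cos_wrightAngle_pos hβ)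
  · refine (ae_restrict_iff' measurableSet_Ioi).2 (ae_of_all _ fun t ht z _ => ?_)
    have ht' : 0 < t := ht
    have h : HasDerivAt (fun z : ℂ => -(z * wrightDir β * (t ^ β : ℝ)))
        (-(wrightDir β * (t ^ β : ℝ))) z := by
      simp_rw [mul_assoc]
      exact (hasDerivAt_mul_const _).fun_neg
    refine (((h.cexp).const_sub 1).const_mul _ |>.const_mul _).congr_deriv ?_
    rw [wrightKernel, Real.rpow_sub_one ht'.ne']
    push_cast
    ring

/-- Weighted AM-GM with weights `β` and `1 - β`: sublinear growth of `t^β` lets half of the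
exponential decay absorb `exp(|x| t^β)`. -/
theorem exists_mul_rpow_le {β : ℝ} (hβ : 0 < β ∧ β < 1) {c : ℝ} (hc : 0 < c) {x : ℝ}
    (hx : 0 ≤ x) : ∃ K : ℝ, ∀ t : ℝ, 0 < t → x * t ^ β ≤ K + c * t := by
  refine ⟨(x / c ^ β) ^ (1 / (1 - β)), fun t ht => ?_⟩
  have hq : 0 ≤ x / c ^ β := by positivity
  have h := Real.geom_mean_le_arith_mean2_weighted (w₁ := β) (w₂ := 1 - β) (p₁ := c * t)
    (p₂ := (x / c ^ β) ^ (1 / (1 - β))) hβ.1.le (by linarith [hβ.2]) (by positivity)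
    (by positivity) (by ring)
  have h1 : (0 : ℝ) < 1 - β := by linarith [hβ.2]
  rw [← Real.rpow_mul hq, one_div, inv_mul_cancel₀ h1.ne', Real.rpow_one,
    Real.mul_rpow hc.le ht.le] at h
  have e : c ^ β * t ^ β * (x / c ^ β) = x * t ^ β := by
    field_simp
  rw [e] at h
  have h2 : 0 ≤ (x / c ^ β) ^ (1 / (1 - β)) := by positivity
  rw [one_div] at *
  have h3 : 0 < c * t := by positivity
  nlinarith [hβ.1, hβ.2]

/-- Expand the last exponential of the kernel in powers of `x` and integrate termwise; each term is
a Gamma integral along the ray of `w̄`. -/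
theorem hasSum_wrightIntegral {β : ℝ} (hβ : 0 < β ∧ β < 1) (x : ℝ) :
    HasSum (fun n : ℕ => ((-x) ^ n / (n.factorial : ℝ) : ℝ) * (Real.Gamma (β * (n + 1)) : ℂ) *
      Complex.exp (Real.pi * (β * (n + 1)) * Complex.I)) (wrightIntegral β x) := by
  have hc := cos_wrightAngle_pos hβ
  set c := Real.cos (wrightAngle β) with hcdef
  let F : ℕ → ℝ → ℂ := fun n t => ((t ^ (β - 1) : ℝ) : ℂ) * (Complex.exp (-(wrightDirConj β * t)) *
    (wrightDir β * ((-(x * wrightDir β * (t ^ β : ℝ))) ^ n / (n.factorial : ℂ))))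
  have hF (n : ℕ) : Measurable (F n) := by fun_prop
  have hFn (n : ℕ) {t : ℝ} (ht : 0 < t) : ‖F n t‖ = t ^ (β - 1) * Real.exp (-(c * t)) *
      ((|x| * t ^ β) ^ n / n.factorial) := by
    simp only [F]
    rw [norm_mul, norm_mul, norm_mul, Complex.norm_exp_neg_mul_ofReal, Complex.norm_real,
      Real.norm_of_nonneg (Real.rpow_nonneg ht.le _), norm_wrightDir, wrightDirConj_re, norm_div,
      norm_pow, norm_neg, norm_mul, norm_mul, norm_wrightDir, Complex.norm_real, Complex.norm_real,
      Real.norm_of_nonneg (Real.rpow_nonneg ht.le _), Complex.norm_natCast, Real.norm_eq_abs]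
    ring
  have hsumr (t : ℝ) : HasSum (fun n : ℕ => t ^ (β - 1) * Real.exp (-(c * t)) *
      ((|x| * t ^ β) ^ n / n.factorial))
      (t ^ (β - 1) * Real.exp (-(c * t)) * Real.exp (|x| * t ^ β)) := by
    refine HasSum.mul_left _ ?_
    rw [Real.exp_eq_exp_ℝ]
    exact NormedSpace.expSeries_div_hasSum_exp _
  have hint : IntegrableOn (fun t : ℝ => t ^ (β - 1) * Real.exp (-(c * t)) *
      Real.exp (|x| * t ^ β)) (Ioi 0) := by
    obtain ⟨K, hK⟩ := exists_mul_rpow_le hβ (half_pos hc) (abs_nonneg x)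
    refine ((integrableOn_rpow_mul_exp_neg_mul hβ.1 (half_pos hc)).const_mul (Real.exp K)).mono'
      (Measurable.aestronglyMeasurable (by fun_prop))
      ((ae_restrict_iff' measurableSet_Ioi).2 (ae_of_all _ fun t ht => ?_))
    have ht' : 0 < t := ht
    rw [Real.norm_of_nonneg (by positivity), mul_assoc, mul_left_comm (Real.exp K),
      ← Real.exp_add, ← Real.exp_add]
    refine mul_le_mul_of_nonneg_left (Real.exp_le_exp.2 ?_) (by positivity)
    linarith [hK t ht']
  have key := hasSum_integral_of_dominated_convergence (μ := volume.restrict (Ioi (0 : ℝ)))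
    (F := F) (f := wrightKernel β x)
    (fun n t => t ^ (β - 1) * Real.exp (-(c * t)) * ((|x| * t ^ β) ^ n / n.factorial))
    (fun n => (hF n).aestronglyMeasurable)
    (fun n => (ae_restrict_iff' measurableSet_Ioi).2 (ae_of_all _ fun t ht => (hFn n ht).le))
    (ae_of_all _ fun t => (hsumr t).summable)
    (by simp_rw [(hsumr _).tsum_eq]; exact hint)
    (ae_of_all _ fun t => by
      refine HasSum.mul_left _ (HasSum.mul_left _ (HasSum.mul_left _ ?_))
      rw [Complex.exp_eq_exp_ℂ]
      exact NormedSpace.expSeries_div_hasSum_exp _)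
  convert! key using 2 with n
  symm
  have ha : 0 < β * (n + 1) := mul_pos hβ.1 (by positivity)
  have hFe : ∀ t ∈ Ioi (0 : ℝ), F n t =
      (((-x) ^ n / (n.factorial : ℝ) : ℝ) * wrightDir β ^ (n + 1)) *
        (((t ^ (β * (n + 1) - 1) : ℝ) : ℂ) * Complex.exp (-(wrightDirConj β * t))) := by
    intro t ht
    have ht' : 0 < t := ht
    have e : t ^ (β * (n + 1) - 1) = t ^ (β - 1) * (t ^ β) ^ n := by
      rw [← Real.rpow_natCast, ← Real.rpow_mul ht'.le, ← Real.rpow_add ht']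
      congr 1; ring
    rw [e]
    simp only [F]
    rw [show -(x * wrightDir β * ((t ^ β : ℝ) : ℂ)) = -x * wrightDir β * (t ^ β : ℝ) by ring,
      mul_pow, mul_pow]
    push_cast
    ring
  rw [setIntegral_congr_fun measurableSet_Ioi hFe, integral_const_mul,
    Complex.integral_rpow_mul_exp_neg_mul ha (by rwa [wrightDirConj_re]),
    wrightDirConj_cpow hβ, wrightDir, ← Complex.exp_nat_mul]
  have h1 : (1 + β : ℂ) ≠ 0 := by
    have : (1 + β : ℝ) ≠ 0 := by linarith [hβ.1]
    exact_mod_cast this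
  have he : Complex.exp (((n + 1 : ℕ) : ℂ) * (wrightAngle β * Complex.I)) *
      Complex.exp (wrightAngle β * (β * (n + 1) : ℝ) * Complex.I) =
      Complex.exp (Real.pi * (β * (n + 1)) * Complex.I) := by
    rw [← Complex.exp_add]
    congr 1
    rw [wrightAngle]
    push_cast
    field_simp
  rw [← he]
  ring

/-- Imaginary parts turn the coefficients into `Γ(a) sin(πa)` with `a = β(n+1)`, which reflection
converts to `π / Γ(1 - a)`. -/
theorem mWright_eq {β : ℝ} (hβ : 0 < β ∧ β < 1) (x : ℝ) :
    mWright β x = (wrightIntegral β x).im / Real.pi := by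
  have h := ((hasSum_wrightIntegral hβ x).mapL Complex.imCLM).div_const Real.pi
  refine Eq.trans ?_ h.tsum_eq
  rw [mWright]
  congr 1
  funext n
  have ha : 0 < β * (n + 1) := mul_pos hβ.1 (by positivity)
  have e : (1 - β - β * n : ℝ) = 1 - β * (n + 1) := by ring
  rw [e, div_mul_eq_div_div, div_eq_mul_one_div, Real.one_div_Gamma_one_sub ha,
    Complex.imCLM_apply]
  have e2 : Complex.exp (Real.pi * (β * (n + 1)) * Complex.I) =
      Complex.exp (((Real.pi * (β * (n + 1)) : ℝ) : ℂ) * Complex.I) := by push_cast; rfl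
  rw [e2, ← Complex.ofReal_mul, Complex.im_ofReal_mul, Complex.exp_ofReal_mul_I_im]
  ring

/-! ### The real primitive of the `M`-Wright function. -/

theorem ofReal_mul_wrightDir_re (β x : ℝ) :
    ((x : ℂ) * wrightDir β).re = x * Real.cos (wrightAngle β) := by
  rw [Complex.re_ofReal_mul, wrightDir_re]

/-- The real primitive of the `M`-Wright function that vanishes at `0`. -/
noncomputable def wrightRealCDF (β x : ℝ) : ℝ := (wrightPrimitive β x).im / Real.pi

theorem hasDerivAt_wrightRealCDF {β : ℝ} (hβ : 0 < β ∧ β < 1) {x : ℝ} (hx : 0 < x) :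
    HasDerivAt (wrightRealCDF β) (mWright β x) x := by
  have hz : 0 < ((x : ℂ) * wrightDir β).re := by
    rw [ofReal_mul_wrightDir_re]; exact mul_pos hx (cos_wrightAngle_pos hβ)
  have h := (hasDerivAt_wrightPrimitive hβ hz).comp_ofReal
  have h2 := (Complex.imCLM.hasFDerivAt.comp_hasDerivAt x h).div_const Real.pi
  rw [mWright_eq hβ]
  exact h2

theorem abs_wrightRealCDF_le {β : ℝ} (hβ : 0 < β ∧ β < 1) {x : ℝ} (hx : 0 ≤ x) :
    |wrightRealCDF β x| ≤ x * wrightBound β / Real.pi := by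
  rw [wrightRealCDF, abs_div, abs_of_pos Real.pi_pos]
  gcongr
  refine (Complex.abs_im_le_norm _).trans ?_
  have h := norm_wrightPrimitive_le hβ (z := x)
    (by rw [ofReal_mul_wrightDir_re]; exact mul_nonneg hx (cos_wrightAngle_pos hβ).le)
  rwa [Complex.norm_real, Real.norm_of_nonneg hx] at h

theorem wrightRealCDF_zero {β : ℝ} (hβ : 0 < β ∧ β < 1) : wrightRealCDF β 0 = 0 := by
  simpa using abs_wrightRealCDF_le hβ le_rfl

theorem continuousOn_wrightRealCDF {β : ℝ} (hβ : 0 < β ∧ β < 1) :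
    ContinuousOn (wrightRealCDF β) (Ici 0) := by
  intro x hx
  rcases (show (0 : ℝ) ≤ x from hx).eq_or_lt with h | h
  · subst h
    rw [ContinuousWithinAt, wrightRealCDF_zero hβ]
    refine squeeze_zero_norm' (a := fun x => x * wrightBound β / Real.pi) ?_ ?_
    · filter_upwards [self_mem_nhdsWithin] with y hy
      exact abs_wrightRealCDF_le hβ hy
    · have : Continuous (fun x => x * wrightBound β / Real.pi) := by fun_prop
      simpa using (this.tendsto 0).mono_left (nhdsWithin_le_nhds (s := Ici 0))
  · exact (hasDerivAt_wrightRealCDF hβ h).continuousAt.continuousWithinAt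

theorem abs_mWright_le {β : ℝ} (hβ : 0 < β ∧ β < 1) {x : ℝ} (hx : 0 ≤ x) :
    |mWright β x| ≤ wrightBound β / Real.pi := by
  rw [mWright_eq hβ, abs_div, abs_of_pos Real.pi_pos]
  gcongr
  refine (Complex.abs_im_le_norm _).trans (norm_wrightIntegral_le hβ ?_)
  rw [ofReal_mul_wrightDir_re]; exact mul_nonneg hx (cos_wrightAngle_pos hβ).le

theorem aemeasurable_mWright {β : ℝ} (hβ : 0 < β ∧ β < 1) :
    AEMeasurable (mWright β) (volume.restrict (Ioi 0)) := by
  refine ⟨deriv (wrightRealCDF β), measurable_deriv _, ?_⟩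
  exact (ae_restrict_iff' measurableSet_Ioi).2
    (ae_of_all _ fun x hx => (hasDerivAt_wrightRealCDF hβ hx).deriv.symm)

theorem integrableOn_mWright_Ioc {β : ℝ} (hβ : 0 < β ∧ β < 1) (x : ℝ) :
    IntegrableOn (mWright β) (Ioc 0 x) := by
  refine IntegrableOn.of_bound (C := wrightBound β / Real.pi) (by simp)
    ((aemeasurable_mWright hβ).mono_measure
      (Measure.restrict_mono Ioc_subset_Ioi_self le_rfl)).aestronglyMeasurable ?_
  exact (ae_restrict_iff' measurableSet_Ioc).2 (ae_of_all _ fun y hy => abs_mWright_le hβ hy.1.le)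

theorem integral_mWright_Ioc {β : ℝ} (hβ : 0 < β ∧ β < 1) {x : ℝ} (hx : 0 ≤ x) :
    ∫ y in Ioc 0 x, mWright β y = wrightRealCDF β x := by
  rw [← intervalIntegral.integral_of_le hx,
    intervalIntegral.integral_eq_sub_of_hasDerivAt_of_le hx
      ((continuousOn_wrightRealCDF hβ).mono Icc_subset_Ici_self)
      (fun y hy => hasDerivAt_wrightRealCDF hβ hy.1)
      ((intervalIntegrable_iff_integrableOn_Ioc_of_le hx).2 (integrableOn_mWright_Ioc hβ x)),
    wrightRealCDF_zero hβ, sub_zero]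

/-! ### The Mellin transform of the `M`-Wright function. -/

theorem wrightDir_mul_cpow {β : ℝ} (hβ : 0 < β ∧ β < 1) {r : ℝ} (hr : 0 < r) (s : ℝ) :
    (wrightDir β * (r : ℂ)) ^ (-s : ℂ) =
      Complex.exp (-(wrightAngle β * s * Complex.I)) * ((r ^ (-s) : ℝ) : ℂ) := by
  have h := wrightAngle_mem hβ
  have hp := Real.pi_pos
  have hw : wrightDir β ≠ 0 := Complex.exp_ne_zero _
  have hl : Complex.log (wrightDir β) = wrightAngle β * Complex.I := by
    rw [wrightDir, Complex.log_exp]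
    · simp; linarith [h.1]
    · simp; linarith [h.2]
  rw [Complex.cpow_def_of_ne_zero (mul_ne_zero hw (by exact_mod_cast hr.ne')),
    Complex.log_mul_ofReal r hr _ hw, hl, Real.rpow_def_of_pos hr]
  push_cast
  rw [← Complex.exp_add]
  congr 1
  ring

/-- Tonelli, integrating in `x` first: this produces a multiple of `t^(-βs)`, and the remaining
`t^(β(1-s)-1) exp(-ct)` is integrable at `0` because `s < 1`. -/
theorem integrable_rpow_mul_wrightKernel {β : ℝ} (hβ : 0 < β ∧ β < 1) {s : ℝ}
    (hs : 0 < s ∧ s < 1) :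
    Integrable (fun p : ℝ × ℝ => ((p.1 ^ (s - 1) : ℝ) : ℂ) * wrightKernel β p.1 p.2)
      ((volume.restrict (Ioi 0)).prod (volume.restrict (Ioi 0))) := by
  have hc := cos_wrightAngle_pos hβ
  set c := Real.cos (wrightAngle β) with hcdef
  have hm : Measurable (fun p : ℝ × ℝ => ((p.1 ^ (s - 1) : ℝ) : ℂ) * wrightKernel β p.1 p.2) := by
    unfold wrightKernel; fun_prop
  have hnorm {t x : ℝ} (ht : 0 < t) (hx : 0 < x) :
      ‖((x ^ (s - 1) : ℝ) : ℂ) * wrightKernel β x t‖ =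
        t ^ (β - 1) * Real.exp (-(c * t)) * (x ^ (s - 1) * Real.exp (-(c * t ^ β * x))) := by
    rw [norm_mul, norm_wrightKernel β _ ht, Complex.norm_real,
      Real.norm_of_nonneg (Real.rpow_nonneg hx.le _), ofReal_mul_wrightDir_re, ← hcdef,
      show x * c * t ^ β = c * t ^ β * x by ring]
    ring
  have hpos {t : ℝ} (ht : 0 < t) : 0 < c * t ^ β := mul_pos hc (Real.rpow_pos_of_pos ht _)
  refine (integrable_prod_iff' hm.aestronglyMeasurable).2 ⟨?_, ?_⟩
  · refine (ae_restrict_iff' measurableSet_Ioi).2 (ae_of_all _ fun t ht => ?_)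
    refine ((integrableOn_rpow_mul_exp_neg_mul hs.1 (hpos ht)).const_mul
      (t ^ (β - 1) * Real.exp (-(c * t)))).mono'
      (hm.comp measurable_prodMk_right).aestronglyMeasurable ?_
    exact (ae_restrict_iff' measurableSet_Ioi).2 (ae_of_all _ fun x hx => (hnorm ht hx).le)
  · have hcalc : ∀ t ∈ Ioi (0 : ℝ),
        (c ^ (-s) * Real.Gamma s) * (t ^ (β * (1 - s) - 1) * Real.exp (-(c * t))) =
        ∫ x in Ioi (0 : ℝ), ‖((x ^ (s - 1) : ℝ) : ℂ) * wrightKernel β x t‖ := by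
      intro t ht
      have ht' : 0 < t := ht
      rw [setIntegral_congr_fun measurableSet_Ioi fun x hx => hnorm ht hx, integral_const_mul,
        Real.integral_rpow_mul_exp_neg_mul_Ioi hs.1 (hpos ht), one_div,
        Real.inv_rpow (hpos ht).le, ← Real.rpow_neg (hpos ht).le,
        Real.mul_rpow hc.le (Real.rpow_nonneg ht'.le _), ← Real.rpow_mul ht'.le,
        show β * (1 - s) - 1 = (β - 1) + β * -s by ring, Real.rpow_add ht']
      ring
    refine IntegrableOn.congr_fun ?_ hcalc measurableSet_Ioi
    exact (integrableOn_rpow_mul_exp_neg_mul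
      (mul_pos hβ.1 (by linarith [hs.2])) hc).const_mul _

theorem integral_rpow_mul_wrightIntegral {β : ℝ} (hβ : 0 < β ∧ β < 1) {s : ℝ}
    (hs : 0 < s ∧ s < 1) :
    ∫ x in Ioi (0 : ℝ), ((x ^ (s - 1) : ℝ) : ℂ) * wrightIntegral β x =
      Real.Gamma s * Real.Gamma (β * (1 - s)) *
        Complex.exp ((Real.pi * (β * (1 - s)) : ℝ) * Complex.I) := by
  have hc := cos_wrightAngle_pos hβ
  simp_rw [wrightIntegral, ← integral_const_mul]
  rw [integral_integral_swap (integrable_rpow_mul_wrightKernel hβ hs)]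
  have hcalc : ∀ t ∈ Ioi (0 : ℝ),
      ∫ x in Ioi (0 : ℝ), ((x ^ (s - 1) : ℝ) : ℂ) * wrightKernel β x t =
      (Real.Gamma s * (wrightDir β * Complex.exp (-(wrightAngle β * s * Complex.I)))) *
        (((t ^ (β * (1 - s) - 1) : ℝ) : ℂ) * Complex.exp (-(wrightDirConj β * t))) := by
    intro t ht
    have ht' : 0 < t := ht
    have hr : 0 < (wrightDir β * ((t ^ β : ℝ) : ℂ)).re := by
      rw [Complex.re_mul_ofReal, wrightDir_re]
      exact mul_pos hc (Real.rpow_pos_of_pos ht' _)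
    have e : ∀ x : ℝ, ((x ^ (s - 1) : ℝ) : ℂ) * wrightKernel β x t =
        (((t ^ (β - 1) : ℝ) : ℂ) * Complex.exp (-(wrightDirConj β * t)) * wrightDir β) *
        (((x ^ (s - 1) : ℝ) : ℂ) * Complex.exp (-(wrightDir β * ((t ^ β : ℝ) : ℂ) * x))) := by
      intro x
      rw [wrightKernel, show (x : ℂ) * wrightDir β * ((t ^ β : ℝ) : ℂ) =
        wrightDir β * ((t ^ β : ℝ) : ℂ) * x by ring]
      ring
    simp_rw [e]
    rw [integral_const_mul, Complex.integral_rpow_mul_exp_neg_mul hs.1 hr,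
      wrightDir_mul_cpow hβ (Real.rpow_pos_of_pos ht' _), ← Real.rpow_mul ht'.le,
      show β * (1 - s) - 1 = (β - 1) + β * -s by ring, Real.rpow_add ht']
    push_cast
    ring
  rw [setIntegral_congr_fun measurableSet_Ioi hcalc, integral_const_mul,
    Complex.integral_rpow_mul_exp_neg_mul (mul_pos hβ.1 (by linarith [hs.2]))
      (by rwa [wrightDirConj_re]), wrightDirConj_cpow hβ, wrightDir]
  have h1 : (1 + β : ℂ) ≠ 0 := by
    have : (1 + β : ℝ) ≠ 0 := by linarith [hβ.1]
    exact_mod_cast this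
  have he : Complex.exp (wrightAngle β * Complex.I) *
      Complex.exp (-(wrightAngle β * s * Complex.I)) *
      Complex.exp (wrightAngle β * (β * (1 - s) : ℝ) * Complex.I) =
      Complex.exp ((Real.pi * (β * (1 - s)) : ℝ) * Complex.I) := by
    rw [← Complex.exp_add, ← Complex.exp_add]
    congr 1
    rw [wrightAngle]
    push_cast
    field_simp
    ring
  rw [← he]
  ring

theorem integrableOn_rpow_mul_wrightIntegral {β : ℝ} (hβ : 0 < β ∧ β < 1) {s : ℝ}
    (hs : 0 < s ∧ s < 1) :
    IntegrableOn (fun x : ℝ => ((x ^ (s - 1) : ℝ) : ℂ) * wrightIntegral β x) (Ioi 0) := by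
  have h := (integrable_rpow_mul_wrightKernel hβ hs).integral_prod_left
  simp_rw [integral_const_mul] at h
  exact h

theorem rpow_mul_mWright_eq {β : ℝ} (hβ : 0 < β ∧ β < 1) (s x : ℝ) :
    x ^ (s - 1) * mWright β x =
      (((x ^ (s - 1) : ℝ) : ℂ) * wrightIntegral β x).im / Real.pi := by
  rw [mWright_eq hβ, Complex.im_ofReal_mul, mul_div_assoc]

theorem integrableOn_rpow_mul_mWright {β : ℝ} (hβ : 0 < β ∧ β < 1) {s : ℝ}
    (hs : 0 < s ∧ s < 1) :
    IntegrableOn (fun x : ℝ => x ^ (s - 1) * mWright β x) (Ioi 0) := by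
  simp_rw [rpow_mul_mWright_eq hβ]
  exact (integrableOn_rpow_mul_wrightIntegral hβ hs).im.div_const _

/-- The Mellin transform of the `M`-Wright function. -/
theorem integral_rpow_mul_mWright {β : ℝ} (hβ : 0 < β ∧ β < 1) {s : ℝ} (hs : 0 < s ∧ s < 1) :
    ∫ x in Ioi (0 : ℝ), x ^ (s - 1) * mWright β x =
      Real.Gamma s / Real.Gamma (1 - β * (1 - s)) := by
  simp_rw [rpow_mul_mWright_eq hβ]
  have him := Complex.imCLM.integral_comp_comm (integrableOn_rpow_mul_wrightIntegral hβ hs)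
  simp only [Complex.imCLM_apply] at him
  rw [integral_div, him, integral_rpow_mul_wrightIntegral hβ hs, ← Complex.ofReal_mul,
    Complex.im_ofReal_mul, Complex.exp_ofReal_mul_I_im, div_eq_mul_one_div (Real.Gamma s),
    Real.one_div_Gamma_one_sub (mul_pos hβ.1 (by linarith [hs.2]))]
  ring

/-! ### Nonnegativity of the `M`-Wright function and the distribution function of its law. -/

theorem lintegral_mWright_eq_one {β : ℝ} [IsProbabilityMeasure (mWrightMeasure β)] :
    ∫⁻ x in Ioi 0, ENNReal.ofReal (mWright β x) = 1 := by
  have h : mWrightMeasure β univ = 1 := measure_univ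
  rwa [mWrightMeasure, withDensity_apply _ MeasurableSet.univ, Measure.restrict_univ] at h

/-- If the positive part of the `M`-Wright function has total mass one, then the function is
nonnegative: its integral is one as well. -/
theorem mWright_nonneg_ae {β : ℝ} (hβ : 0 < β ∧ β < 1) [IsProbabilityMeasure (mWrightMeasure β)] :
    ∀ᵐ x ∂volume.restrict (Ioi 0), 0 ≤ mWright β x := by
  set ν : Measure ℝ := volume.restrict (Ioi 0) with hν
  have hae : ∀ᵐ x ∂ν, 0 < x := (ae_restrict_iff' measurableSet_Ioi).2 (ae_of_all _ fun x hx => hx)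
  have hM := aemeasurable_mWright hβ
  set p : ℝ → ℝ := fun x => max (mWright β x) 0 with hp
  set q : ℝ → ℝ := fun x => max (-mWright β x) 0 with hq
  have hpm : AEMeasurable p ν := hM.max aemeasurable_const
  have hqm : AEMeasurable q ν := hM.neg.max aemeasurable_const
  have hp0 (x : ℝ) : 0 ≤ p x := le_max_right _ _
  have hq0 (x : ℝ) : 0 ≤ q x := le_max_right _ _
  have hpq (x : ℝ) : p x - q x = mWright β x := by
    simp only [hp, hq]; exact max_zero_sub_max_neg_zero_eq_self _
  have hpl : ∫⁻ x, ENNReal.ofReal (p x) ∂ν = 1 := by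
    rw [← lintegral_mWright_eq_one (β := β)]
    refine lintegral_congr fun x => ?_
    simp [hp]
  have hpint : Integrable p ν :=
    (lintegral_ofReal_ne_top_iff_integrable hpm.aestronglyMeasurable (ae_of_all _ hp0)).1
      (by rw [hpl]; exact ENNReal.one_ne_top)
  have hpI : ∫ x, p x ∂ν = 1 := by
    rw [integral_eq_lintegral_of_nonneg_ae (ae_of_all _ hp0) hpm.aestronglyMeasurable, hpl]; rfl
  have hpos {s : ℝ} (hs : 0 < s ∧ s < 1) : Integrable (fun x => x ^ (s - 1) * p x) ν := by
    refine (integrableOn_rpow_mul_mWright hβ hs).pos_part.congr ?_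
    filter_upwards [hae] with x hx
    simp only [hp]
    rw [mul_max_of_nonneg _ _ (Real.rpow_nonneg hx.le _), mul_zero]
  -- Exponents in `[1/2, 1)` increasing to `1`: the Mellin transform is only available for `s < 1`,
  -- and `s ≥ 1/2` gives the majorant `x^(s-1) ≤ 1 + x^(-1/2)`.
  let u : ℕ → ℝ := fun n => 1 - 1 / ((n : ℝ) + 2)
  have hu (n : ℕ) : 1 / 2 ≤ u n ∧ u n < 1 := by
    have : (0 : ℝ) ≤ n := n.cast_nonneg
    constructor
    · have : 1 / ((n : ℝ) + 2) ≤ 1 / 2 := by gcongr; linarith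
      simp only [u]; linarith
    · have : 0 < 1 / ((n : ℝ) + 2) := by positivity
      simp only [u]; linarith
  have hu' (n : ℕ) : 0 < u n ∧ u n < 1 := ⟨by linarith [(hu n).1], (hu n).2⟩
  have hulim : Filter.Tendsto u Filter.atTop (nhds 1) := by
    have h : Filter.Tendsto (fun n : ℕ => 1 / ((n : ℝ) + 2)) Filter.atTop (nhds 0) := by
      simp_rw [one_div]
      exact tendsto_inv_atTop_zero.comp
        (Filter.tendsto_atTop_add_const_right _ _ tendsto_natCast_atTop_atTop)
    simpa [u] using h.const_sub 1
  have hlimp : Filter.Tendsto (fun n => ∫ x, x ^ (u n - 1) * p x ∂ν) Filter.atTop (nhds 1) := by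
    rw [show nhds (1 : ℝ) = nhds (∫ x, p x ∂ν) by rw [hpI]]
    refine tendsto_integral_of_dominated_convergence
      (fun x => p x + x ^ ((1 / 2 : ℝ) - 1) * p x)
      (fun n => (hpos (hu' n)).aestronglyMeasurable) (hpint.add (hpos (by norm_num))) ?_ ?_
    · intro n
      filter_upwards [hae] with x hx
      have h0 := Real.rpow_nonneg hx.le (u n - 1)
      rw [Real.norm_of_nonneg (mul_nonneg h0 (hp0 x)), ← one_add_mul]
      refine mul_le_mul_of_nonneg_right ?_ (hp0 x)
      have h2 := Real.rpow_nonneg hx.le ((1 / 2 : ℝ) - 1)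
      rcases le_total x 1 with h1 | h1
      · have := Real.rpow_le_rpow_of_exponent_ge hx h1
          (show (1 / 2 : ℝ) - 1 ≤ u n - 1 by linarith [(hu n).1])
        linarith
      · have := Real.rpow_le_one_of_one_le_of_nonpos h1
          (show u n - 1 ≤ 0 by linarith [(hu n).2])
        linarith
    · filter_upwards [hae] with x hx
      have h : Filter.Tendsto (fun n => x ^ (u n - 1)) Filter.atTop (nhds (x ^ (1 - 1 : ℝ))) :=
        ((Real.continuousAt_const_rpow hx.ne').tendsto).comp (hulim.sub_const 1)
      simpa using h.mul_const (p x)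
  have hlimg : Filter.Tendsto (fun n => Real.Gamma (u n) / Real.Gamma (1 - β * (1 - u n)))
      Filter.atTop (nhds 1) := by
    have hG : ContinuousAt Real.Gamma 1 :=
      (Real.differentiableAt_Gamma fun m h => by
        have : (0 : ℝ) ≤ m := m.cast_nonneg
        linarith).continuousAt
    have h2 : Filter.Tendsto (fun n => 1 - β * (1 - u n)) Filter.atTop (nhds 1) := by
      simpa using ((hulim.const_sub 1).const_mul β).const_sub 1
    have h3 := (hG.tendsto.comp hulim).div (hG.tendsto.comp h2) (by simp)
    simpa using! h3
  -- The weighted mass of the negative part is that of the positive part minus the Mellin transform.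
  -- Both tend to `1`, so Fatou gives the negative part mass `0`.
  have hqn (n : ℕ) : ∫⁻ x, ENNReal.ofReal (x ^ (u n - 1) * q x) ∂ν =
      ENNReal.ofReal (∫ x, x ^ (u n - 1) * p x ∂ν -
        Real.Gamma (u n) / Real.Gamma (1 - β * (1 - u n))) := by
    have hMi := integrableOn_rpow_mul_mWright hβ (hu' n)
    have he : (fun x => x ^ (u n - 1) * q x) =
        fun x => x ^ (u n - 1) * p x - x ^ (u n - 1) * mWright β x := by
      funext x; rw [← hpq]; ring
    have hqi : Integrable (fun x => x ^ (u n - 1) * q x) ν := by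
      rw [he]; exact (hpos (hu' n)).sub hMi
    rw [← integral_rpow_mul_mWright hβ (hu' n), ← integral_sub (hpos (hu' n)) hMi, ← he,
      ofReal_integral_eq_lintegral_ofReal hqi]
    filter_upwards [hae] with x hx
    exact mul_nonneg (Real.rpow_nonneg hx.le _) (hq0 x)
  have hlimq : Filter.Tendsto (fun n => ∫⁻ x, ENNReal.ofReal (x ^ (u n - 1) * q x) ∂ν)
      Filter.atTop (nhds 0) := by
    simp_rw [hqn]
    simpa using ENNReal.tendsto_ofReal (hlimp.sub hlimg)
  have hfatou : ∫⁻ x, ENNReal.ofReal (q x) ∂ν = 0 := by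
    have hle := lintegral_liminf_le' (μ := ν)
      (f := fun n x => ENNReal.ofReal (x ^ (u n - 1) * q x)) (u := Filter.atTop)
      (fun n => ENNReal.measurable_ofReal.comp_aemeasurable
        ((by fun_prop : Measurable fun x : ℝ => x ^ (u n - 1)).aemeasurable.mul hqm))
    rw [hlimq.liminf_eq] at hle
    refine le_antisymm (le_trans (le_of_eq (lintegral_congr_ae ?_)) hle) zero_le
    filter_upwards [hae] with x hx
    have h : Filter.Tendsto (fun n => x ^ (u n - 1)) Filter.atTop (nhds (x ^ (1 - 1 : ℝ))) :=
      ((Real.continuousAt_const_rpow hx.ne').tendsto).comp (hulim.sub_const 1)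
    have h2 := ENNReal.tendsto_ofReal (h.mul_const (q x))
    simp only [sub_self, Real.rpow_zero, one_mul] at h2
    exact h2.liminf_eq.symm
  have hq_zero := (lintegral_eq_zero_iff'
    (ENNReal.measurable_ofReal.comp_aemeasurable hqm)).1 hfatou
  filter_upwards [hq_zero] with x hx
  have h : q x ≤ 0 := by simpa using hx
  have := le_max_left (-mWright β x) 0
  simp only [hq] at h
  linarith

theorem mWrightMeasure_Iic {β : ℝ} (hβ : 0 < β ∧ β < 1) [IsProbabilityMeasure (mWrightMeasure β)]
    {x : ℝ} (hx : 0 ≤ x) :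
    mWrightMeasure β (Iic x) = ENNReal.ofReal (wrightRealCDF β x) := by
  rw [mWrightMeasure, withDensity_apply _ measurableSet_Iic,
    Measure.restrict_restrict measurableSet_Iic, inter_comm, Ioi_inter_Iic,
    ← integral_mWright_Ioc hβ hx,
    ofReal_integral_eq_lintegral_ofReal (integrableOn_mWright_Ioc hβ x)]
  exact ae_mono (Measure.restrict_mono Ioc_subset_Ioi_self le_rfl) (mWright_nonneg_ae hβ)

theorem mWrightMeasure_Iic_of_nonpos (β : ℝ) {x : ℝ} (hx : x ≤ 0) :
    mWrightMeasure β (Iic x) = 0 := by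
  rw [mWrightMeasure, withDensity_apply _ measurableSet_Iic,
    Measure.restrict_restrict measurableSet_Iic, inter_comm, Ioi_inter_Iic,
    Ioc_eq_empty (by simpa using hx)]
  simp

theorem wrightRealCDF_mem_Icc {β : ℝ} (hβ : 0 < β ∧ β < 1)
    [IsProbabilityMeasure (mWrightMeasure β)] {x : ℝ} (hx : 0 ≤ x) :
    wrightRealCDF β x ∈ Icc 0 1 := by
  refine ⟨?_, ?_⟩
  · rw [← integral_mWright_Ioc hβ hx]
    exact integral_nonneg_of_ae
      (ae_mono (Measure.restrict_mono Ioc_subset_Ioi_self le_rfl) (mWright_nonneg_ae hβ))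
  · have h : mWrightMeasure β (Iic x) ≤ 1 := prob_le_one
    rw [mWrightMeasure_Iic hβ hx] at h
    simpa using h

/-! ### Holomorphic functions on sectors and their averages over dilations. -/

/-- The open sector of slope `k` around the positive real axis. -/
def realSector (k : ℝ) : Set ℂ := {z | |z.im| < k * z.re}

theorem isOpen_realSector (k : ℝ) : IsOpen (realSector k) :=
  isOpen_lt (by fun_prop) (by fun_prop)

theorem re_pos_of_mem_realSector {k : ℝ} (hk : 0 < k) {z : ℂ} (hz : z ∈ realSector k) :
    0 < z.re :=
  pos_of_mul_pos_right ((abs_nonneg _).trans_lt hz) hk.le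

theorem ofReal_mem_realSector {k : ℝ} (hk : 0 < k) {x : ℝ} (hx : 0 < x) :
    (x : ℂ) ∈ realSector k := by
  simpa [realSector] using mul_pos hk hx

theorem mul_ofReal_mem_realSector {k : ℝ} {z : ℂ} (hz : z ∈ realSector k) {y : ℝ} (hy : 0 < y) :
    z * y ∈ realSector k := by
  have h : |z.im| < k * z.re := hz
  simp only [realSector, mem_ofPred_eq, Complex.im_mul_ofReal, Complex.re_mul_ofReal, abs_mul,
    abs_of_pos hy]
  nlinarith

/-- Move vertically from `Re z` to `z`: the path has length at most `k · Re z`, which cancels the `1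
/ Re z` in the derivative bound. -/
theorem norm_le_of_deriv_le_on_realSector {k C : ℝ} (hk : 0 < k) {H : ℂ → ℂ}
    (hd : DifferentiableOn ℂ H (realSector k))
    (hC : ∀ z ∈ realSector k, ‖deriv H z‖ ≤ C / z.re)
    (hb : ∀ x : ℝ, 0 < x → ‖H x‖ ≤ 1) {z : ℂ} (hz : z ∈ realSector k) :
    ‖H z‖ ≤ 1 + C * k := by
  have hz0 := re_pos_of_mem_realSector hk hz
  have hzk : |z.im| < k * z.re := hz
  have hconv : Convex ℝ (({z.re} : Set ℝ) ×ℂ Ioo (-(k * z.re)) (k * z.re)) :=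
    ((convex_singleton z.re).linear_preimage Complex.reLm).inter
      ((convex_Ioo _ _).linear_preimage Complex.imLm)
  have hsub : ∀ w ∈ (({z.re} : Set ℝ) ×ℂ Ioo (-(k * z.re)) (k * z.re)),
      w ∈ realSector k ∧ w.re = z.re := by
    intro w hw
    have h1 : w.re = z.re := hw.1
    exact ⟨by rw [realSector, mem_ofPred_eq, h1, abs_lt]; exact hw.2, h1⟩
  have h := hconv.norm_image_sub_le_of_norm_hasDerivWithin_le (f := H) (f' := deriv H)
    (C := C / z.re) (x := (z.re : ℂ)) (y := z)
    (fun w hw => ((hd.differentiableAt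
      ((isOpen_realSector k).mem_nhds (hsub w hw).1)).hasDerivAt).hasDerivWithinAt)
    (fun w hw => by have := hC w (hsub w hw).1; rwa [(hsub w hw).2] at this)
    ⟨by simp, by simpa using mul_pos hk hz0⟩ ⟨by simp, abs_lt.1 hzk⟩
  have hzr : ‖z - (z.re : ℂ)‖ = |z.im| := by
    have : z - (z.re : ℂ) = z.im * Complex.I := by
      apply Complex.ext <;> simp
    rw [this]; simp
  have hC0 : 0 ≤ C / z.re := (norm_nonneg _).trans (hC z hz)
  calc ‖H z‖ = ‖H z.re + (H z - H z.re)‖ := by rw [add_sub_cancel]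
    _ ≤ 1 + C / z.re * |z.im| := by
      refine (norm_add_le _ _).trans (add_le_add (hb _ hz0) ?_)
      rwa [hzr] at h
    _ ≤ 1 + C / z.re * (k * z.re) := by gcongr
    _ = 1 + C * k := by field_simp

/-- Averages over dilations of a holomorphic function on a sector are holomorphic. -/
theorem differentiableOn_integral_comp_mul {k C : ℝ} (hk : 0 < k) {H : ℂ → ℂ}
    (hd : DifferentiableOn ℂ H (realSector k))
    (hC : ∀ z ∈ realSector k, ‖deriv H z‖ ≤ C / z.re)
    (hb : ∀ x : ℝ, 0 < x → ‖H x‖ ≤ 1) (ρ : Measure ℝ) [IsFiniteMeasure ρ] :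
    DifferentiableOn ℂ (fun ζ : ℂ => ∫ y in Ioi (0 : ℝ), H (ζ * y) ∂ρ) (realSector k) := by
  intro ζ₀ hζ₀
  have h₀ := re_pos_of_mem_realSector hk hζ₀
  have oS := isOpen_realSector k
  have hmaps {ζ : ℂ} (hζ : ζ ∈ realSector k) :
      MapsTo (fun y : ℝ => ζ * (y : ℂ)) (Ioi 0) (realSector k) :=
    fun y hy => mul_ofReal_mem_realSector hζ hy
  have hm {G : ℂ → ℂ} (hG : ContinuousOn G (realSector k)) {ζ : ℂ} (hζ : ζ ∈ realSector k) :
      AEStronglyMeasurable (fun y : ℝ => G (ζ * y)) (ρ.restrict (Ioi 0)) :=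
    (hG.comp (by fun_prop) (hmaps hζ)).aestronglyMeasurable measurableSet_Ioi
  have hs : realSector k ∩ {z | ζ₀.re / 2 < z.re} ∈ nhds ζ₀ :=
    Filter.inter_mem (oS.mem_nhds hζ₀)
      ((isOpen_lt continuous_const Complex.continuous_re).mem_nhds (by simpa using h₀))
  refine (hasDerivAt_integral_of_dominated_loc_of_deriv_le
    (μ := ρ.restrict (Ioi 0))
    (F := fun ζ (y : ℝ) => H (ζ * y)) (F' := fun ζ (y : ℝ) => deriv H (ζ * y) * y)
    (bound := fun _ => C / (ζ₀.re / 2)) hs ?_ ?_ ?_ ?_ ?_ ?_).2.differentiableAt.differentiableWithinAt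
  · filter_upwards [oS.mem_nhds hζ₀] with ζ hζ using hm hd.continuousOn hζ
  · refine Integrable.of_bound (hm hd.continuousOn hζ₀) (1 + C * k) ?_
    exact (ae_restrict_iff' measurableSet_Ioi).2 (ae_of_all _ fun y hy =>
      norm_le_of_deriv_le_on_realSector hk hd hC hb (hmaps hζ₀ hy))
  · exact (hm (hd.deriv oS).continuousOn hζ₀).mul
      (Complex.measurable_ofReal.aestronglyMeasurable)
  · refine (ae_restrict_iff' measurableSet_Ioi).2 (ae_of_all _ fun y hy ζ hζ => ?_)
    have hy' : 0 < y := hy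
    have h1 := hC _ (hmaps hζ.1 hy)
    have h2 := re_pos_of_mem_realSector hk hζ.1
    have h3 : ζ₀.re / 2 < ζ.re := hζ.2
    have hC0 : 0 ≤ C := by
      have := mul_nonneg ((norm_nonneg _).trans (hC ζ hζ.1)) h2.le
      rwa [div_mul_cancel₀ _ h2.ne'] at this
    rw [norm_mul, Complex.norm_real, Real.norm_of_nonneg hy'.le]
    rw [Complex.re_mul_ofReal] at h1
    -- The chain-rule factor `y` cancels against the bound at `ζ y`, leaving a majorant independent
    -- of `y`.
    calc _ ≤ C / (ζ.re * y) * y := by gcongr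
      _ = C / ζ.re := by field_simp
      _ ≤ C / (ζ₀.re / 2) := by gcongr
  · exact integrable_const _
  · refine (ae_restrict_iff' measurableSet_Ioi).2 (ae_of_all _ fun y hy ζ hζ => ?_)
    exact ((hd.differentiableAt (oS.mem_nhds (hmaps hζ.1 hy))).hasDerivAt).comp ζ
      (hasDerivAt_mul_const (y : ℂ))

/-! ### The distribution function on a sector. -/

/-- The holomorphic extension of `wrightRealCDF` to a sector. -/
noncomputable def wrightCDF (β : ℝ) (z : ℂ) : ℂ :=
  (wrightPrimitive β z - (starRingEnd ℂ) (wrightPrimitive β ((starRingEnd ℂ) z))) /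
    (2 * Real.pi * Complex.I)

/-- Taking an imaginary part is not holomorphic, but `(f(z) - conj f(conj z)) / 2i` is, and equals
`Im f` on the real axis. -/
theorem wrightCDF_ofReal (β x : ℝ) : wrightCDF β x = wrightRealCDF β x := by
  have hp : (Real.pi : ℂ) ≠ 0 := by exact_mod_cast Real.pi_ne_zero
  rw [wrightCDF, wrightRealCDF, Complex.conj_ofReal, Complex.sub_conj]
  push_cast
  field_simp

/-- Here `Re(zw) = cos θ · Re z - sin θ · Im z`; a sector of slope `cos θ / 2` sacrifices at most
half of the first term. -/
theorem le_re_mul_wrightDir {β : ℝ} (hβ : 0 < β ∧ β < 1) {z : ℂ}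
    (hz : z ∈ realSector (Real.cos (wrightAngle β) / 2)) :
    Real.cos (wrightAngle β) / 2 * z.re ≤ (z * wrightDir β).re := by
  have hz' : |z.im| < Real.cos (wrightAngle β) / 2 * z.re := hz
  rw [Complex.mul_re, wrightDir_re, wrightDir_im]
  have h := wrightAngle_mem hβ
  have h0 : 0 ≤ Real.sin (wrightAngle β) :=
    (Real.sin_pos_of_pos_of_lt_pi h.1 (by linarith [h.2, Real.pi_pos])).le
  have h1 : z.im * Real.sin (wrightAngle β) ≤ |z.im| :=
    (mul_le_mul_of_nonneg_right (le_abs_self _) h0).trans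
      (mul_le_of_le_one_right (abs_nonneg _) (Real.sin_le_one _))
  linarith

theorem hasDerivAt_wrightCDF {β : ℝ} (hβ : 0 < β ∧ β < 1) {z : ℂ}
    (hz : z ∈ realSector (Real.cos (wrightAngle β) / 2)) :
    HasDerivAt (wrightCDF β)
      ((wrightIntegral β z - (starRingEnd ℂ) (wrightIntegral β ((starRingEnd ℂ) z))) /
        (2 * Real.pi * Complex.I)) z := by
  have hc := half_pos (cos_wrightAngle_pos hβ)
  have hz' : (starRingEnd ℂ) z ∈ realSector (Real.cos (wrightAngle β) / 2) := by
    simpa [realSector] using hz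
  have hpos {w : ℂ} (hw : w ∈ realSector (Real.cos (wrightAngle β) / 2)) :
      0 < (w * wrightDir β).re :=
    (mul_pos hc (re_pos_of_mem_realSector hc hw)).trans_le (le_re_mul_wrightDir hβ hw)
  have h1 := hasDerivAt_wrightPrimitive hβ (hpos hz)
  have h2 := (hasDerivAt_wrightPrimitive hβ (hpos hz')).conj_conj
  rw [Complex.conj_conj] at h2
  exact (h1.sub h2).div_const _

theorem norm_deriv_wrightCDF_le {β : ℝ} (hβ : 0 < β ∧ β < 1) {z : ℂ}
    (hz : z ∈ realSector (Real.cos (wrightAngle β) / 2)) :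
    ‖deriv (wrightCDF β) z‖ ≤ 1 / (β * (Real.cos (wrightAngle β) / 2)) / Real.pi / z.re := by
  have hc := half_pos (cos_wrightAngle_pos hβ)
  have hz' : (starRingEnd ℂ) z ∈ realSector (Real.cos (wrightAngle β) / 2) := by
    simpa [realSector] using hz
  have hb {w : ℂ} (hw : w ∈ realSector (Real.cos (wrightAngle β) / 2)) :
      ‖wrightIntegral β w‖ ≤ 1 / (β * (Real.cos (wrightAngle β) / 2 * w.re)) := by
    have h0 := mul_pos hc (re_pos_of_mem_realSector hc hw)
    have h1 := le_re_mul_wrightDir hβ hw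
    refine (norm_wrightIntegral_le_inv hβ (h0.trans_le h1)).trans ?_
    have := hβ.1
    gcongr
  have hp := Real.pi_pos
  have hr := re_pos_of_mem_realSector hc hz
  rw [(hasDerivAt_wrightCDF hβ hz).deriv, norm_div, norm_mul, norm_mul, Complex.norm_I,
    Complex.norm_real, Real.norm_of_nonneg hp.le, Complex.norm_ofNat, mul_one]
  have h1 := hb hz
  have h2 := hb hz'
  rw [Complex.conj_re] at h2
  calc _ ≤ (1 / (β * (Real.cos (wrightAngle β) / 2 * z.re)) +
        1 / (β * (Real.cos (wrightAngle β) / 2 * z.re))) / (2 * Real.pi) := by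
        gcongr
        refine (norm_sub_le _ _).trans (add_le_add h1 ?_)
        rwa [RCLike.norm_conj]
    _ = _ := by
        have := hβ.1.ne'
        have := (cos_wrightAngle_pos hβ).ne'
        field_simp
        ring

theorem measurable_wrightRealCDF (β : ℝ) : Measurable (wrightRealCDF β) := by
  have h : StronglyMeasurable (fun p : ℝ × ℝ => wrightPrimitiveKernel β p.1 p.2) := by
    unfold wrightPrimitiveKernel
    exact Measurable.stronglyMeasurable (by fun_prop)
  have h2 : Measurable fun x : ℝ => wrightPrimitive β x :=
    (h.integral_prod_right' (ν := volume.restrict (Ioi 0))).measurable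
  exact (Complex.measurable_im.comp h2).div_const _

theorem analyticOnNhd_integral_wrightRealCDF {β : ℝ} (hβ : 0 < β ∧ β < 1)
    [IsProbabilityMeasure (mWrightMeasure β)] (ρ : Measure ℝ) [IsFiniteMeasure ρ] :
    AnalyticOnNhd ℝ (fun ε : ℝ => ∫ y in Ioi (0 : ℝ), wrightRealCDF β (ε ^ 2 * y) ∂ρ)
      (Ioi 0) := by
  have hc := half_pos (cos_wrightAngle_pos hβ)
  have hd : DifferentiableOn ℂ (wrightCDF β) (realSector (Real.cos (wrightAngle β) / 2)) :=
    fun z hz => (hasDerivAt_wrightCDF hβ hz).differentiableAt.differentiableWithinAt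
  have h := differentiableOn_integral_comp_mul hc hd
    (fun z hz => norm_deriv_wrightCDF_le hβ hz) (fun x hx => by
      have := wrightRealCDF_mem_Icc hβ hx.le
      rw [wrightCDF_ofReal, Complex.norm_real, Real.norm_of_nonneg this.1]
      exact this.2) ρ
  have ha := h.analyticOnNhd (isOpen_realSector _)
  intro ε hε
  have hε' : 0 < ε := hε
  have h1 := (ha _ (ofReal_mem_realSector hc (pow_pos hε' 2))).re_ofReal
  have h2 : AnalyticAt ℝ (fun ε : ℝ => ε ^ 2) ε := analyticAt_id.pow 2
  have h3 := AnalyticAt.fun_comp (f := fun ε : ℝ => ε ^ 2) (x := ε) h1 h2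
  refine h3.congr (Filter.Eventually.of_forall fun δ => ?_)
  simp only
  simp_rw [← Complex.ofReal_mul, wrightCDF_ofReal]
  rw [integral_complex_ofReal, Complex.ofReal_re]

/-! ### The product of `√l` with an independent variable. -/

/-- The conventions `toReal ⊤ = 0` and `0⁻¹ = 0` send both `r = 0` and `r = ⊤` to the point `0`,
outside `Ioi 0`. The first contributes full mass through the separate indicator; the second forces
`l ≤ 0`, a null event. -/
theorem mWrightMeasure_sqrt_mul_le {β : ℝ} (hβ : 0 < β ∧ β < 1)
    [IsProbabilityMeasure (mWrightMeasure β)] (r : ℝ≥0∞) {ε : ℝ} (hε : 0 < ε) :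
    mWrightMeasure β {l | ENNReal.ofReal √l * r ≤ ENNReal.ofReal ε} =
      ({0} : Set ℝ≥0∞).indicator 1 r + (Ioi (0 : ℝ)).indicator
        (fun y => ENNReal.ofReal (wrightRealCDF β (ε ^ 2 * y))) (r.toReal ^ 2)⁻¹ := by
  rcases eq_or_ne r 0 with rfl | h0
  · simp
  rcases eq_or_ne r ⊤ with rfl | ht
  · have : {l : ℝ | ENNReal.ofReal √l * ⊤ ≤ ENNReal.ofReal ε} = Iic 0 := by
      ext l
      rcases le_or_gt l 0 with hl | hl
      · simp [hl, Real.sqrt_eq_zero_of_nonpos hl]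
      · simp [hl, ENNReal.mul_top, Real.sqrt_pos.2 hl]
    simp [this, mWrightMeasure_Iic_of_nonpos]
  have hr : 0 < r.toReal := ENNReal.toReal_pos h0 ht
  have hy : (0 : ℝ) < (r.toReal ^ 2)⁻¹ := by positivity
  have : {l : ℝ | ENNReal.ofReal √l * r ≤ ENNReal.ofReal ε} =
      Iic (ε ^ 2 * (r.toReal ^ 2)⁻¹) := by
    ext l
    have e : ENNReal.ofReal √l * r = ENNReal.ofReal (√l * r.toReal) := by
      rw [ENNReal.ofReal_mul (Real.sqrt_nonneg _), ENNReal.ofReal_toReal ht]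
    rw [mem_ofPred_eq, e, ENNReal.ofReal_le_ofReal_iff hε.le, mem_Iic, ← le_div_iff₀ hr,
      Real.sqrt_le_left (by positivity), div_pow, div_eq_mul_inv]
  rw [this, mWrightMeasure_Iic hβ (by positivity)]
  simp [h0, hy]

/-- The cumulative distribution function of `√l · R`, where `l` has the `M`-Wright law and is
independent of `R`, is real-analytic on the positive half-line. -/
theorem analyticOnNhd_prod_mWrightMeasure {β : ℝ} (hβ : 0 < β ∧ β < 1)
    [IsProbabilityMeasure (mWrightMeasure β)] {Ω : Type*} [MeasurableSpace Ω] (P : Measure Ω)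
    [IsProbabilityMeasure P] {R : Ω → ℝ≥0∞} (hR : AEMeasurable R P) :
    AnalyticOnNhd ℝ (fun ε => ((mWrightMeasure β).prod P).real
      {p | ENNReal.ofReal √p.1 * R p.2 ≤ ENNReal.ofReal ε}) (Ioi 0) := by
  wlog hRm : Measurable R generalizing R
  · refine (this hR.measurable_mk.aemeasurable hR.measurable_mk).congr isOpen_Ioi fun ε _ => ?_
    refine measureReal_congr ?_
    have h := (Measure.quasiMeasurePreserving_snd (μ := mWrightMeasure β) (ν := P)).ae hR.ae_eq_mk
    filter_upwards [h] with p hp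
    change (_ ≤ _) = (_ ≤ _)
    rw [hp]
  set Y : Ω → ℝ := fun ω => ((R ω).toReal ^ 2)⁻¹ with hY
  have hYm : Measurable Y := by fun_prop
  have : IsProbabilityMeasure (P.map Y) := Measure.isProbabilityMeasure_map hYm.aemeasurable
  refine ((analyticOnNhd_const (v := P.real {ω | R ω = 0})).add
    (analyticOnNhd_integral_wrightRealCDF hβ (P.map Y))).congr isOpen_Ioi fun ε hε => ?_
  have hε' : 0 < ε := hε
  have hcm : Measurable fun y => wrightRealCDF β (ε ^ 2 * y) :=
    (measurable_wrightRealCDF β).comp (measurable_const_mul _)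
  have hset : MeasurableSet
      {p : ℝ × Ω | ENNReal.ofReal √p.1 * R p.2 ≤ ENNReal.ofReal ε} :=
    measurableSet_le (by fun_prop) measurable_const
  have hicc : ∀ᵐ y ∂(P.map Y).restrict (Ioi 0), wrightRealCDF β (ε ^ 2 * y) ∈ Icc 0 1 :=
    (ae_restrict_iff' measurableSet_Ioi).2 (ae_of_all _ fun y hy =>
      wrightRealCDF_mem_Icc hβ (mul_nonneg (sq_nonneg ε) (le_of_lt hy)))
  have hnn : 0 ≤ᵐ[(P.map Y).restrict (Ioi 0)] fun y => wrightRealCDF β (ε ^ 2 * y) :=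
    hicc.mono fun y hy => hy.1
  have hint : Integrable (fun y => wrightRealCDF β (ε ^ 2 * y)) ((P.map Y).restrict (Ioi 0)) :=
    Integrable.of_bound hcm.aestronglyMeasurable 1 (hicc.mono fun y hy => by
      rw [Real.norm_of_nonneg hy.1]; exact hy.2)
  have key : ((mWrightMeasure β).prod P)
      {p : ℝ × Ω | ENNReal.ofReal √p.1 * R p.2 ≤ ENNReal.ofReal ε} =
      P {ω | R ω = 0} +
        ENNReal.ofReal (∫ y in Ioi (0 : ℝ), wrightRealCDF β (ε ^ 2 * y) ∂(P.map Y)) := by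
    rw [Measure.prod_apply_symm hset, ofReal_integral_eq_lintegral_ofReal hint hnn,
      ← lintegral_indicator measurableSet_Ioi,
      lintegral_map (hcm.ennreal_ofReal.indicator measurableSet_Ioi) hYm]
    have h0 : MeasurableSet {ω | R ω = 0} := hRm (measurableSet_singleton 0)
    rw [← lintegral_indicator_one h0, ← lintegral_add_left (measurable_one.indicator h0)]
    refine lintegral_congr fun ω => ?_
    exact mWrightMeasure_sqrt_mul_le hβ (R ω) hε'
  have hI : 0 ≤ ∫ y in Ioi (0 : ℝ), wrightRealCDF β (ε ^ 2 * y) ∂(P.map Y) :=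
    integral_nonneg_of_ae hnn
  symm
  rw [measureReal_def, key, ENNReal.toReal_add (measure_ne_top _ _) ENNReal.ofReal_ne_top,
    ENNReal.toReal_ofReal hI]
  rfl

/-! ### Norms of generalized grey Brownian motion. -/

theorem IsGeneralizedGreyBM.analyticOnNhd_seminorm {α β : ℝ} (hβ : 0 < β ∧ β < 1)
    {Ω Ω' : Type*} [MeasurableSpace Ω] [MeasurableSpace Ω'] {P : Measure Ω} {P' : Measure Ω'}
    [IsProbabilityMeasure P] {γ : ℝ≥0} {N : Seminorm ℝ (HolderZero γ)} (hN : Measurable N)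
    {B : Ω' → HolderZero γ} (hBm : AEMeasurable B P')
    (hB : IsFractionalBM (α / 2) (fun t ω => (B ω : unitInterval → ℝ) t) P')
    {X : Ω → HolderZero γ} (hXm : AEMeasurable X P)
    (hX : IsGeneralizedGreyBM α β (fun t ω => (X ω : unitInterval → ℝ) t) P) :
    AnalyticOnNhd ℝ (fun ε => P.real {ω | N (X ω) ≤ ε}) (Ioi 0) := by
  have := hX.isProbabilityMeasure_mWrightMeasure
  have := hB.gaussian.isProbabilityMeasure
  have hBc : AEMeasurable (fun ω => (B ω : unitInterval → ℝ)) P' :=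
    measurable_subtype_coe.comp_aemeasurable hBm
  have hg : Measurable fun p : ℝ × (unitInterval → ℝ) => fun t => √p.1 * p.2 t := by fun_prop
  have hlaw := identDistrib_of_forall_finset (P := P) (P' := (mWrightMeasure β).prod P')
    (X := fun t ω => (X ω : unitInterval → ℝ) t)
    (Y := fun t (p : ℝ × Ω') => √p.1 * (B p.2 : unitInterval → ℝ) t)
    (measurable_subtype_coe.comp_aemeasurable hXm)
    (hg.comp_aemeasurable (measurable_fst.aemeasurable.prodMk hBc.comp_snd))
    (hX.identDistrib_prod hB)
  refine (analyticOnNhd_prod_mWrightMeasure hβ P' (R := fun ω => ENNReal.ofReal (N (B ω)))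
    (hN.comp_aemeasurable hBm).ennreal_ofReal).congr isOpen_Ioi fun ε hε => ?_
  -- The ball is the trace of a set `S` measurable for the point evaluations on all functions, so
  -- equality of laws on `unitInterval → ℝ` applies to it.
  obtain ⟨S, hS, hSN⟩ : MeasurableSet {f : HolderZero γ | N f ≤ ε} :=
    measurableSet_le hN measurable_const
  have h := hlaw.measure_mem_eq hS
  have e1 : (fun ω t => (X ω : unitInterval → ℝ) t) ⁻¹' S = {ω | N (X ω) ≤ ε} := by
    change X ⁻¹' (Subtype.val ⁻¹' S) = _
    rw [hSN]; rfl
  have e2 : (fun (p : ℝ × Ω') t => √p.1 * (B p.2 : unitInterval → ℝ) t) ⁻¹' S =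
      {p | ENNReal.ofReal √p.1 * ENNReal.ofReal (N (B p.2)) ≤ ENNReal.ofReal ε} := by
    change (fun p : ℝ × Ω' => √p.1 • B p.2) ⁻¹' (Subtype.val ⁻¹' S) = _
    rw [hSN]
    ext p
    simp only [mem_preimage, mem_ofPred_eq]
    rw [← ENNReal.ofReal_mul (Real.sqrt_nonneg _),
      ENNReal.ofReal_le_ofReal_iff (le_of_lt hε), map_smul_eq_mul,
      Real.norm_of_nonneg (Real.sqrt_nonneg _)]
  rw [e1, e2] at h
  rw [measureReal_def, measureReal_def, h]

/-- Continuity of the paths reduces the supremum to a dense sequence, hence to a measurable event.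
The process `B` supplied by the definition need not have continuous paths, so its supremum over that
sequence is taken in `ℝ≥0∞` and may be infinite. -/
theorem IsGeneralizedGreyBM.analyticOnNhd_iSup {α β : ℝ} (hβ : 0 < β ∧ β < 1)
    {Ω : Type*} [MeasurableSpace Ω] {P : Measure Ω} [IsProbabilityMeasure P]
    {X : unitInterval → Ω → ℝ} (hX : IsGeneralizedGreyBM α β X P)
    (hcont : ∀ᵐ ω ∂P, Continuous (fun t => X t ω)) :
    AnalyticOnNhd ℝ (fun ε => P.real {ω | ⨆ t, |X t ω| ≤ ε}) (Ioi 0) := by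
  classical
  have := hX.isProbabilityMeasure_mWrightMeasure
  obtain ⟨Ω', _, P', -, B, hP', -, hB, -⟩ := id hX
  let d : ℕ → unitInterval := TopologicalSpace.denseSeq unitInterval
  have hBm (t : unitInterval) : AEMeasurable (B t) P' := hB.gaussian.aemeasurable t
  have hBp (t : unitInterval) : AEMeasurable (fun p : ℝ × Ω' => √p.1 * B t p.2)
      ((mWrightMeasure β).prod P') :=
    measurable_fst.sqrt.aemeasurable.mul (hBm t).comp_snd
  have hXm (t : unitInterval) : AEMeasurable (X t) P :=
    (measurable_pi_apply (⟨t, Finset.mem_singleton_self t⟩ : ({t} : Finset unitInterval))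
      ).comp_aemeasurable (hX.identDistrib_prod hB {t}).aemeasurable_fst
  have hlaw := identDistrib_of_forall_finset (P := P) (P' := (mWrightMeasure β).prod P')
    (X := fun n ω => X (d n) ω) (Y := fun n (p : ℝ × Ω') => √p.1 * B (d n) p.2)
    (aemeasurable_pi_lambda _ fun n => hXm (d n)) (aemeasurable_pi_lambda _ fun n => hBp (d n))
    (fun I => by
      -- The dense sequence may repeat points, so the coordinates indexed by `I` are read off from
      -- those indexed by its image.
      let u : (I.image d → ℝ) → I → ℝ := fun x n => x ⟨d n, Finset.mem_image_of_mem d n.2⟩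
      have hu : Measurable u := by fun_prop
      exact (hX.identDistrib_prod hB (I.image d)).comp hu)
  refine (analyticOnNhd_prod_mWrightMeasure hβ P' (R := fun ω => ⨆ n, ENNReal.ofReal |B (d n) ω|)
    (AEMeasurable.iSup fun n => (hBm (d n)).abs.ennreal_ofReal)).congr isOpen_Ioi fun ε hε => ?_
  have hε' : 0 < ε := hε
  set S : Set (ℕ → ℝ) := {x | ∀ n, |x n| ≤ ε} with hSdef
  have hS : MeasurableSet S := by
    rw [hSdef, ofPred_forall]
    exact MeasurableSet.iInter fun n => measurableSet_le (by fun_prop) measurable_const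
  have h := hlaw.measure_mem_eq hS
  have e1 : {ω | ⨆ t, |X t ω| ≤ ε} =ᵐ[P] (fun ω n => X (d n) ω) ⁻¹' S := by
    filter_upwards [hcont] with ω hω
    refine propext (?_ : ⨆ t, |X t ω| ≤ ε ↔ ∀ n, |X (d n) ω| ≤ ε)
    rw [ciSup_le_iff (isCompact_range hω.abs).bddAbove]
    refine ⟨fun h n => h _, fun h => ?_⟩
    have hcl : IsClosed {t | |X t ω| ≤ ε} := isClosed_le hω.abs continuous_const
    have hsub : range d ⊆ {t | |X t ω| ≤ ε} := by rintro _ ⟨n, rfl⟩; exact h n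
    exact fun t => hcl.closure_subset_iff.2 hsub (TopologicalSpace.denseRange_denseSeq _ t)
  have e2 : (fun (p : ℝ × Ω') n => √p.1 * B (d n) p.2) ⁻¹' S =
      {p | ENNReal.ofReal √p.1 * (⨆ n, ENNReal.ofReal |B (d n) p.2|) ≤ ENNReal.ofReal ε} := by
    ext p
    simp only [mem_preimage, mem_ofPred_eq, hSdef, ENNReal.mul_iSup, iSup_le_iff]
    refine forall_congr' fun n => ?_
    rw [← ENNReal.ofReal_mul (Real.sqrt_nonneg _), ENNReal.ofReal_le_ofReal_iff hε'.le, abs_mul,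
      abs_of_nonneg (Real.sqrt_nonneg _)]
  rw [e2] at h
  rw [measureReal_def, measureReal_def, measure_congr e1, h]

theorem proposition1 (α β : ℝ) (hα : 0 < α ∧ α < 2) (hβ : 0 < β ∧ β < 1)
    {Ω : Type*} [MeasurableSpace Ω] (P : Measure Ω) [IsProbabilityMeasure P]
    {Ω' : Type*} [MeasurableSpace Ω'] (P' : Measure Ω') [IsProbabilityMeasure P'] :
    -- norms on the Hölder space that satisfy the small ball estimate for fBm `B`, `H = α / 2`
    (∀ (γ : ℝ≥0), 0 < γ → (γ : ℝ) < α / 2 →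
      ∀ N : Seminorm ℝ (HolderZero γ), (∀ f, N f = 0 → f = 0) → Measurable N →
      ∀ B : Ω' → HolderZero γ, AEMeasurable B P' →
        IsFractionalBM (α / 2) (fun t ω => (B ω : unitInterval → ℝ) t) P' →
        SmallBallEstimate (fun ε => P'.real {ω | N (B ω) ≤ ε}) →
      ∀ X : Ω → HolderZero γ, AEMeasurable X P →
        IsGeneralizedGreyBM α β (fun t ω => (X ω : unitInterval → ℝ) t) P →
        AnalyticOnNhd ℝ (fun ε => P.real {ω | N (X ω) ≤ ε}) (Ioi 0)) ∧
    -- the sup norm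
    (∀ X : unitInterval → Ω → ℝ, IsGeneralizedGreyBM α β X P →
      (∀ᵐ ω ∂P, Continuous (fun t => X t ω)) →
      AnalyticOnNhd ℝ (fun ε => P.real {ω | ⨆ t, |X t ω| ≤ ε}) (Ioi 0)) :=
  ⟨fun _ _ _ _ _ hN _ hBm hB _ _ hXm hX => hX.analyticOnNhd_seminorm hβ hN hBm hB hXm,
    fun _ hX hcont => hX.analyticOnNhd_iSup hβ hcont⟩
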